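/- All topological groups are Hausdorff, and t.d.l.c. means totally disconnected and locally compact. A topological group is compactly generated if it is generated, as an abstract group, by a compact subset. A t.d.l.c. group $H$ is regionally expansive if it has a compactly generated open subgroup $O$ and a compact open subgroup $V \leq O$ whose normal core $\bigcap_{g \in O} gVg^{-1}$ in $O$ is trivial. A topological group is topologically simple if it is non-trivial and has no closed normal subgroups other than the trivial subgroup and itself. Let $\mathscr{R}$ be the class of robustly monolithic groups, that is, of those t.d.l.c. groups $G$ for which the intersection $\mathrm{Mon}(G)$ of all non-trivial closed normal subgroups of $G$ is non-trivial and, with the subspace topology, non-discrete, regionally expansive and topologically simple. For a prime $p$, a pro-$p$-Sylow subgroup of a profinite group $U$ is a closed subgroup of $U$ that is maximal among the pro-$p$ subgroups of $U$. A group is virtually solvable if it has a solvable subgroup of finite index. Corollary. Let $G \in \mathscr{R}$, let $U$ be a compact open subgroup of $G$, let $p$ be a prime, and let $S$ be a pro-$p$-Sylow subgroup of $U$. If $S$ is infinite, then the only virtually solvable normal subgroup of $S$ is the trivial group. In particular, $S$ is not solvable. -/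

import Mathlib

/-- The group `H` has a solvable subgroup of finite index. -/
def IsVirtuallySolvable (H : Type*) [Group H] : Prop :=
  ∃ K : Subgroup H, K.FiniteIndex ∧ Group.IsSolvable K

/-- A topological group is compactly generated if some compact subset generates it
as an abstract group. -/
def IsCompactlyGeneratedGroup (H : Type*) [Group H] [TopologicalSpace H] : Prop :=
  ∃ X : Set H, IsCompact X ∧ Subgroup.closure X = ⊤

/-- A topological group `H` is regionally expansive if it has a compactly generated open subgroup
`O`, which in turn has a compact open subgroup `U` with trivial normal core in `O`. -/
def IsRegionallyExpansive (H : Type*) [Group H] [TopologicalSpace H] : Prop :=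
  ∃ O : Subgroup H, IsOpen (O : Set H) ∧ IsCompactlyGeneratedGroup O ∧
    ∃ U : Subgroup O, IsCompact (U : Set O) ∧ IsOpen (U : Set O) ∧ U.normalCore = ⊥

/-- A topological group is topologically simple if it is non-trivial and its only closed normal
subgroups are the trivial subgroup and the whole group. -/
def IsTopologicallySimple (H : Type*) [Group H] [TopologicalSpace H] : Prop :=
  Nontrivial H ∧ ∀ N : Subgroup H, N.Normal → IsClosed (N : Set H) → N = ⊥ ∨ N = ⊤

/-- The intersection of all non-trivial closed normal subgroups of `G`. -/
def monolith (G : Type*) [Group G] [TopologicalSpace G] : Subgroup G :=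
  sInf {N : Subgroup G | N.Normal ∧ IsClosed (N : Set G) ∧ N ≠ ⊥}

/-- `G` is monolithic if the intersection of all non-trivial closed normal subgroups is
non-trivial. -/
def IsMonolithic (G : Type*) [Group G] [TopologicalSpace G] : Prop :=
  monolith G ≠ ⊥

/-- A topological group `G` is robustly monolithic if it is a totally disconnected locally compact
(Hausdorff) group which is monolithic, and whose monolith is non-discrete, regionally expansive and
topologically simple. -/
structure IsRobustlyMonolithic (G : Type*) [Group G] [TopologicalSpace G] : Prop where
  isTopologicalGroup : IsTopologicalGroup G
  t2Space : T2Space G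
  locallyCompactSpace : LocallyCompactSpace G
  totallyDisconnectedSpace : TotallyDisconnectedSpace G
  isMonolithic : IsMonolithic G
  not_discreteTopology : ¬ DiscreteTopology (monolith G)
  isRegionallyExpansive : IsRegionallyExpansive (monolith G)
  isTopologicallySimple : IsTopologicallySimple (monolith G)

/-- A pro-`p` group: a profinite group all of whose quotients by open normal subgroups are
(finite) `p`-groups. -/
structure IsProP (p : ℕ) (H : Type*) [Group H] [TopologicalSpace H] : Prop where
  isTopologicalGroup : IsTopologicalGroup H
  compactSpace : CompactSpace H
  t2Space : T2Space H
  totallyDisconnectedSpace : TotallyDisconnectedSpace H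
  isPGroup_quotient :
    ∀ (N : Subgroup H) [N.Normal], IsOpen (N : Set H) → IsPGroup p (H ⧸ N)

/-- A pro-`p`-Sylow subgroup of a profinite group `P`: a closed subgroup that is maximal among the
pro-`p` subgroups of `P`. -/
structure IsProPSylow (p : ℕ) {P : Type*} [Group P] [TopologicalSpace P] (S : Subgroup P) :
    Prop where
  isClosed : IsClosed (S : Set P)
  isProP : IsProP p S
  maximal : ∀ T : Subgroup P, IsClosed (T : Set P) → IsProP p T → S ≤ T → T = S

/-!
Let `M` be the monolith of `G` and let `S` be regarded as a compact subgroup of `G`. The proof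
passes to the group `H = localCommensurator S` of all elements of `G` that commensurate `S`.

* Sylow theory. If `S` is a pro-`p`-Sylow subgroup of `U`, every open subgroup of `U` containing
  `S` has index prime to `p` (`IsProPSylow.not_dvd_index`), so that Sylow's conjugacy theorem
  holds, also inside closed subgroups of `U` that contain `S`
  (`exists_conj_mem_of_forall_not_dvd_index`). A Frattini argument then shows that `H` is dense in
  `G` and that `H ∩ M` is dense in `M` (`exists_mul_mem_localCommensurator`).
* Expansivity. For every subgroup `D` such that `D ∩ M` is dense in `M` there are a finite subset
  `X` of `D ∩ M` and an identity neighbourhood in `G` that contains no non-trivial subgroup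
  normalised by `X` (`IsExpansiveMonolith.exists_finset_forall_eq_bot`). This applies to every
  non-trivial normal subgroup `D` of `H` (`IsExpansiveMonolith.subset_closure_inf`).
* Finite normal subgroups of `S`, and more generally the discrete ones, are centralised by small
  elements of `S`. Elements of `H` with that property form a normal subgroup `D` of `H`; if it
  were non-trivial, a finite set `X` as above would centralise a small open subgroup of `S`
  (`IsExpansiveMonolith.eq_bot_of_discrete`).
* Let `L` be a non-trivial abelian normal subgroup of `S`. For a finite set `F ⊆ H` let `C F` be
  the group of all elements of `H` that centralise the germ at `1` of `h L h⁻¹` for each `h ∈ F`.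
  It is normalised by these conjugates, and it contains arbitrarily small non-trivial elements,
  since finitely many abelian normal subgroups centralise a common non-trivial normal subgroup.
  Choosing `X` in the normal closure of `L` in `H`, compactness shows that the closures of the
  `C F`, taken in the topology on `H` that makes `S` an open subgroup, have a non-trivial
  intersection. This intersection is normal in `H`, so it contains a finite set `X'` as above; but
  each element of `X'` is the product of an element of `S` and one centralising a germ of `L`, so
  `X'` normalises small subgroups `L ∩ W`. Hence `L` is discrete, and therefore trivial
  (`IsExpansiveMonolith.eq_bot_of_commute`).
* A virtually solvable group is finite or has a non-trivial abelian characteristic subgroup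
  (`Subgroup.eq_bot_of_isVirtuallySolvable`).
-/

open Filter Topology
open scoped Pointwise

/-! ### Sylow theory in profinite groups -/

/-- A subgroup of index prime to `p` contains a conjugate of every `p`-subgroup. -/
theorem IsPGroup.exists_conj_mem_of_not_dvd_index {p : ℕ} [Fact p.Prime] {R : Type*} [Group R]
    [Finite R] (S T : Subgroup R) (hT : IsPGroup p T) (hS : ¬ p ∣ S.index) :
    ∃ y : R, ∀ t ∈ T, y⁻¹ * t * y ∈ S := by
  obtain ⟨a, ha⟩ := hT.nonempty_fixed_point_of_prime_not_dvd_card (R ⧸ S) hS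
  obtain ⟨y, rfl⟩ := QuotientGroup.mk_surjective a
  refine ⟨y, fun t ht => ?_⟩
  have h : ((t * y : R) : R ⧸ S) = y := ha ⟨t, ht⟩
  have := QuotientGroup.eq.1 h.symm
  simpa [mul_assoc] using this

theorem Subgroup.relIndex_sup_dvd {P : Type*} [Group P] (A B N : Subgroup P) [N.Normal] :
    (A ⊔ N).relIndex (B ⊔ N) ∣ A.relIndex B := by
  have h := Subgroup.relIndex_map_map (QuotientGroup.mk' N) A B
  rw [QuotientGroup.ker_mk'] at h
  rw [← h]
  let f : B →* (B.map (QuotientGroup.mk' N)) := (QuotientGroup.mk' N).subgroupMap B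
  have hf : Function.Surjective f := (QuotientGroup.mk' N).subgroupMap_surjective B
  have h2 := (A.subgroupOf B).index_map_dvd hf
  have h3 : (A.subgroupOf B).map f ≤ (A.map (QuotientGroup.mk' N)).subgroupOf
      (B.map (QuotientGroup.mk' N)) := by
    rintro _ ⟨x, hx, rfl⟩
    exact ⟨x, hx, rfl⟩
  exact (Subgroup.index_dvd_of_le h3).trans h2

section Profinite

variable {P : Type*} [Group P] [TopologicalSpace P] [IsTopologicalGroup P] [CompactSpace P]
  [TotallyDisconnectedSpace P]

theorem exists_open_normal_le {A : Set P} (hA : A ∈ 𝓝 (1 : P)) :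
    ∃ N : Subgroup P, N.Normal ∧ IsOpen (N : Set P) ∧ (N : Set P) ⊆ A := by
  obtain ⟨A', hA', hAo, h1⟩ := mem_nhds_iff.1 hA
  obtain ⟨N, hN⟩ := ProfiniteGrp.exist_openNormalSubgroup_sub_open_nhds_of_one hAo h1
  exact ⟨N.toSubgroup, N.isNormal', N.isOpen', hN.trans hA'⟩

/-- The open subgroups containing a pro-`p`-Sylow subgroup have index prime to `p`. By Zorn's lemma
some closed subgroup containing `S` is minimal with this property; such a minimal subgroup is
pro-`p`, because the preimages of Sylow subgroups of its finite quotients inherit the property. -/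
theorem IsProPSylow.not_dvd_index [T2Space P] {p : ℕ} [Fact p.Prime] {S : Subgroup P}
    (hS : IsProPSylow p S) {B : Subgroup P} (hB : IsOpen (B : Set P)) (hSB : S ≤ B) :
    ¬ p ∣ B.index := by
  let F : Set (Set P) := {A | ∃ C : Subgroup P, (C : Set P) = A ∧ IsClosed A ∧ S ≤ C ∧
    ∀ B : Subgroup P, IsOpen (B : Set P) → C ≤ B → ¬ p ∣ B.index}
  obtain ⟨A, hA⟩ : ∃ A, Minimal (· ∈ F) A := by
    refine zorn_superset F fun c hcF hc => ?_
    rcases c.eq_empty_or_nonempty with rfl | hne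
    · refine ⟨Set.univ, ⟨⊤, by simp, isClosed_univ, le_top, fun B _ hB => ?_⟩, by simp⟩
      rw [top_le_iff.1 hB, Subgroup.index_top]
      exact (Fact.out : p.Prime).not_dvd_one
    · have hcl : IsClosed (⋂₀ c) := isClosed_sInter fun A hA => (hcF hA).choose_spec.2.1
      refine ⟨⋂₀ c, ⟨sInf {C : Subgroup P | (C : Set P) ∈ c}, ?_, hcl, ?_, ?_⟩,
        fun A hA => Set.sInter_subset_of_mem hA⟩
      · ext x
        simp only [Subgroup.coe_sInf, Set.mem_ofPred_eq, Set.mem_iInter, Set.mem_sInter]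
        refine ⟨fun h A hA => ?_, fun h C hC => h _ hC⟩
        obtain ⟨C, rfl, -⟩ := hcF hA
        exact h C hA
      · refine le_sInf fun C hC => ?_
        obtain ⟨C', h, -, hC', -⟩ := hcF hC
        exact (SetLike.coe_injective h) ▸ hC'
      · intro B hB hCB
        have : ∃ A ∈ c, A ⊆ (B : Set P) := by
          have hne' : Nonempty c := hne.to_subtype
          have hcc : ∀ A : c, IsClosed (A : Set P) := fun A => (hcF A.2).choose_spec.2.1
          have hcB : ∀ x ∈ ⋂ A : c, (A : Set P), (B : Set P) ∈ 𝓝 x := fun x hx => by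
            refine hB.mem_nhds (hCB ?_)
            rw [Subgroup.mem_sInf]
            exact fun C hC => Set.mem_iInter.1 hx ⟨C, hC⟩
          have hdir : Directed (· ⊇ ·) (fun A : c => (A : Set P)) := fun A A' => by
            rcases hc.total A.2 A'.2 with h | h
            · exact ⟨A, subset_rfl, h⟩
            · exact ⟨A', h, subset_rfl⟩
          obtain ⟨A, hA⟩ := exists_subset_nhds_of_isCompact' hdir
            (fun A => (hcc A).isCompact) hcc hcB
          exact ⟨A, A.2, hA⟩
        obtain ⟨A, hA, hAB⟩ := this
        obtain ⟨C, rfl, -, -, hC⟩ := hcF hA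
        exact hC B hB hAB
  obtain ⟨⟨C, rfl, hCc, hSC, hC⟩, hmin⟩ := hA
  have hprop : IsProP p C := by
    have hCcomp : CompactSpace C := isCompact_iff_compactSpace.1 hCc.isCompact
    refine ⟨inferInstance, hCcomp, inferInstance, inferInstance, fun N hN hNo => ?_⟩
    have hfin : Finite (C ⧸ N) := N.quotient_finite_of_isOpen hNo
    -- The image of `S` in `C ⧸ N` lies in a Sylow subgroup, whose preimage is again in the family.
    have hSp : IsPGroup p ((S.subgroupOf C).map (QuotientGroup.mk' N)) := by
      rintro ⟨_, s, hs, rfl⟩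
      have hcont : Continuous (Subgroup.inclusion hSC) := by
        rw [continuous_induced_rng]
        exact continuous_subtype_val
      obtain ⟨k, hk⟩ := hS.isProP.isPGroup_quotient (N.comap (Subgroup.inclusion hSC))
        (hNo.preimage hcont) (QuotientGroup.mk ⟨s, hs⟩)
      refine ⟨k, ?_⟩
      rw [← QuotientGroup.mk_pow, QuotientGroup.eq_one_iff] at hk
      ext
      rw [Subgroup.coe_pow, Subgroup.coe_one, ← map_pow, QuotientGroup.mk'_apply,
        QuotientGroup.eq_one_iff]
      exact hk
    obtain ⟨Q, hQ⟩ := hSp.exists_le_sylow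
    have hQo : IsOpen ((Q.comap (QuotientGroup.mk' N) : Subgroup C) : Set C) := by
      refine Subgroup.isOpen_mono (H₁ := N) (fun x hx => ?_) hNo
      rw [Subgroup.mem_comap, QuotientGroup.mk'_apply, (QuotientGroup.eq_one_iff x).2 hx]
      exact one_mem _
    set D : Subgroup P := (Q.comap (QuotientGroup.mk' N)).map C.subtype with hD
    have hDF : (D : Set P) ∈ F := by
      refine ⟨D, rfl, ?_, ?_, ?_⟩
      · rw [hD, Subgroup.coe_map]
        exact hCc.isClosedEmbedding_subtypeVal.isClosedMap _
          (Subgroup.isClosed_of_isOpen (G := C) _ hQo)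
      · intro s hs
        exact ⟨⟨s, hSC hs⟩, hQ ⟨⟨s, hSC hs⟩, hs, rfl⟩, rfl⟩
      · intro B hB hDB hpB
        obtain ⟨N₀, hN₀, hN₀o, hN₀B⟩ := exists_open_normal_le (hB.mem_nhds (one_mem B))
        have h1 : p ∣ (D ⊔ N₀).index :=
          hpB.trans (Subgroup.index_dvd_of_le (sup_le hDB hN₀B))
        have hDC : D ≤ C := Subgroup.map_subtype_le _
        rw [← Subgroup.relIndex_mul_index (sup_le_sup_right hDC N₀)] at h1
        rcases (Fact.out : p.Prime).dvd_mul.1 h1 with h2 | h2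
        · have h3 := h2.trans (Subgroup.relIndex_sup_dvd D C N₀)
          have h4 : D.relIndex C = Q.index := by
            rw [Subgroup.relIndex, hD, Subgroup.subgroupOf,
              Subgroup.comap_map_eq_self_of_injective C.subtype_injective]
            exact Subgroup.index_comap_of_surjective _ (QuotientGroup.mk'_surjective N)
          rw [h4] at h3
          exact Q.not_dvd_index h3
        · exact hC _ (Subgroup.isOpen_mono le_sup_right hN₀o) le_sup_left h2
    have hle : C ≤ D := hmin hDF (Subgroup.map_subtype_le _)
    have htop : (Q : Subgroup (C ⧸ N)) = ⊤ := by
      refine eq_top_iff.2 fun x _ => ?_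
      obtain ⟨c, rfl⟩ := QuotientGroup.mk_surjective x
      obtain ⟨c', hc', h⟩ := hle c.2
      rw [← Subtype.ext h]
      exact hc'
    intro x
    obtain ⟨k, hk⟩ := Q.isPGroup' ⟨x, htop ▸ Subgroup.mem_top x⟩
    exact ⟨k, congrArg Subtype.val hk⟩
  have hCS : C = S := hS.maximal C hCc hprop hSC
  exact hC B hB (hCS.trans_le hSB)

/-- Sylow's conjugacy theorem for a closed subgroup `R` of a profinite group. The condition on `T`
says that each of its elements topologically generates a pro-`p` group; it is phrased by
neighbourhoods of `1` so as not to depend on the ambient group. -/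
theorem exists_conj_mem_of_forall_not_dvd_index {p : ℕ} [Fact p.Prime] {S R T : Subgroup P}
    (hSc : IsClosed (S : Set P)) (hRc : IsClosed (R : Set P)) (hSR : S ≤ R) (hTR : T ≤ R)
    (hS : ∀ B : Subgroup P, IsOpen (B : Set P) → S ≤ B → ¬ p ∣ B.index)
    (hT : ∀ t ∈ T, ∀ A ∈ 𝓝 (1 : P), ∃ k : ℕ, t ^ p ^ k ∈ A) :
    ∃ y ∈ R, ∀ t ∈ T, y⁻¹ * t * y ∈ S := by
  let ι := {N : Subgroup P // N.Normal ∧ IsOpen (N : Set P)}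
  let Y : ι → Set P := fun N => R ∩ ⋂ t ∈ T, {y | y⁻¹ * t * y ∈ S ⊔ N.1}
  have hYc : ∀ N, IsClosed (Y N) := fun N => by
    refine hRc.inter (isClosed_biInter fun t _ => ?_)
    have : IsClosed ((S ⊔ N.1 : Subgroup P) : Set P) :=
      Subgroup.isClosed_of_isOpen _ (Subgroup.isOpen_mono le_sup_right N.2.2)
    exact this.preimage (by fun_prop)
  have hYn : ∀ N, (Y N).Nonempty := by
    rintro ⟨N, hN, hNo⟩
    have hfin : Finite (P ⧸ N) := N.quotient_finite_of_isOpen hNo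
    let π := QuotientGroup.mk' N
    have hTp : IsPGroup p ((T.map π).subgroupOf (R.map π)) := by
      rintro ⟨⟨a, ha⟩, t, ht, h⟩
      obtain ⟨k, hk⟩ := hT t ht N (hNo.mem_nhds (one_mem N))
      refine ⟨k, ?_⟩
      have h1 : a = π t := h.symm
      have h2 : a ^ p ^ k = 1 := by
        rw [h1, ← map_pow]
        exact (QuotientGroup.eq_one_iff (N := N) (t ^ p ^ k)).2 hk
      exact Subtype.ext (Subtype.ext h2)
    have hSp : ¬ p ∣ ((S.map π).subgroupOf (R.map π)).index := by
      intro hdvd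
      refine hS (S ⊔ N) (Subgroup.isOpen_mono le_sup_right hNo) le_sup_left ?_
      have h1 := Subgroup.relIndex_map_map π S R
      rw [QuotientGroup.ker_mk'] at h1
      rw [← Subgroup.relIndex_mul_index (sup_le_sup_right hSR N), ← h1]
      exact dvd_mul_of_dvd_left hdvd _
    obtain ⟨⟨_, y, hy, rfl⟩, h⟩ := IsPGroup.exists_conj_mem_of_not_dvd_index _ _ hTp hSp
    refine ⟨y, hy, Set.mem_iInter₂.2 fun t ht => ?_⟩
    obtain ⟨s, hs, h2⟩ := h ⟨π t, t, hTR ht, rfl⟩ ⟨t, ht, rfl⟩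
    have h3 : π s = π (y⁻¹ * t * y) := by
      rw [map_mul, map_mul, map_inv]
      exact h2
    have h4 : s⁻¹ * (y⁻¹ * t * y) ∈ N := QuotientGroup.eq.1 h3
    have := Subgroup.mul_mem_sup hs h4
    simpa using this
  have : Nonempty ι := ⟨⟨⊤, inferInstance, isOpen_univ⟩⟩
  have hdir : Directed (· ⊇ ·) Y := fun N N' => by
    have := N.2.1
    have := N'.2.1
    refine ⟨⟨N.1 ⊓ N'.1, inferInstance, N.2.2.inter N'.2.2⟩, ?_, ?_⟩
    · exact Set.inter_subset_inter_right _ (Set.iInter₂_mono fun t _ y hy =>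
        sup_le_sup_left (inf_le_left (a := N.1) (b := N'.1)) S hy)
    · exact Set.inter_subset_inter_right _ (Set.iInter₂_mono fun t _ y hy =>
        sup_le_sup_left (inf_le_right (a := N.1) (b := N'.1)) S hy)
  obtain ⟨y, hy⟩ := IsCompact.nonempty_iInter_of_directed_nonempty_isCompact_isClosed Y
    hdir hYn (fun N => (hYc N).isCompact) hYc
  refine ⟨y, (Set.mem_iInter.1 hy ⟨⊤, inferInstance, isOpen_univ⟩).1, fun t ht => ?_⟩
  by_contra hcon
  have hnhds : {g : P | y⁻¹ * t * y * g ∉ S} ∈ 𝓝 (1 : P) := by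
    refine (hSc.isOpen_compl.preimage (continuous_const_mul (y⁻¹ * t * y))).mem_nhds ?_
    simpa using hcon
  obtain ⟨N, hN, hNo, hNS⟩ := exists_open_normal_le hnhds
  have h1 := Set.mem_iInter₂.1 (Set.mem_iInter.1 hy ⟨N, hN, hNo⟩).2 t ht
  obtain ⟨s, hs, n, hn, h2⟩ := Subgroup.mem_sup_of_normal_right.1 h1
  refine hNS (inv_mem hn) ?_
  rw [← h2, mul_inv_cancel_right]
  exact hs

end Profinite

/-! ### The local commensurator of a pro-`p`-Sylow subgroup -/

section Commensurator

variable {G : Type*} [Group G] [TopologicalSpace G]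

/-- The group of those `g` such that conjugation by `g` and by `g⁻¹` both map small elements of
`S` into `S`. For compact `S` these are the `g` for which `g S g⁻¹` and `S` are commensurable. -/
def localCommensurator (S : Subgroup G) : Subgroup G where
  carrier := {g | Tendsto (fun s => g * s * g⁻¹) (𝓝[S] 1) (𝓝[S] 1) ∧
    Tendsto (fun s => g⁻¹ * s * g) (𝓝[S] 1) (𝓝[S] 1)}
  one_mem' := by
    have h : Tendsto (fun s : G => s) (𝓝[S] 1) (𝓝[S] 1) := tendsto_id
    simpa using h
  mul_mem' := by
    intro a b ha hb
    refine ⟨(ha.1.comp hb.1).congr fun s => ?_, (hb.2.comp ha.2).congr fun s => ?_⟩ <;>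
    simp [mul_assoc]
  inv_mem' := by
    intro a ha
    refine ⟨?_, ?_⟩
    · simpa using ha.2
    · simpa using ha.1

variable [IsTopologicalGroup G]

theorem tendsto_conj_one (g : G) : Tendsto (fun x => g * x * g⁻¹) (𝓝 1) (𝓝 1) := by
  have : Continuous fun x : G => g * x * g⁻¹ := by fun_prop
  simpa using this.tendsto 1

theorem tendsto_conj_one' (g : G) : Tendsto (fun x => g⁻¹ * x * g) (𝓝 1) (𝓝 1) := by
  simpa using tendsto_conj_one g⁻¹

theorem mem_localCommensurator {S : Subgroup G} {g : G} :
    g ∈ localCommensurator S ↔ (∀ᶠ s in 𝓝[S] 1, g * s * g⁻¹ ∈ S) ∧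
      ∀ᶠ s in 𝓝[S] 1, g⁻¹ * s * g ∈ S := by
  have h1 : Tendsto (fun s => g * s * g⁻¹) (𝓝[S] 1) (𝓝 1) :=
    (tendsto_conj_one g).mono_left nhdsWithin_le_nhds
  have h2 : Tendsto (fun s => g⁻¹ * s * g) (𝓝[S] 1) (𝓝 1) :=
    (tendsto_conj_one' g).mono_left nhdsWithin_le_nhds
  change (Tendsto _ _ _ ∧ Tendsto _ _ _) ↔ _
  rw [tendsto_nhdsWithin_iff, tendsto_nhdsWithin_iff]
  exact ⟨fun h => ⟨h.1.2, h.2.2⟩, fun h => ⟨⟨h1, h.1⟩, h2, h.2⟩⟩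

theorem le_localCommensurator (S : Subgroup G) : S ≤ localCommensurator S := fun _ hg =>
  mem_localCommensurator.2 ⟨eventually_mem_nhdsWithin.mono fun _ hs =>
    mul_mem (mul_mem hg hs) (inv_mem hg), eventually_mem_nhdsWithin.mono fun _ hs =>
    mul_mem (mul_mem (inv_mem hg) hs) hg⟩

/-- Conjugation by an element of a compact group cannot map a closed subgroup properly into itself,
since `y⁻¹` is a limit of positive powers of `y`. -/
theorem conj_mem_of_forall_conj_mem {U K : Subgroup G} (hU : IsCompact (U : Set G))
    (hK : IsClosed (K : Set G)) {y : G} (hy : y ∈ U) (h : ∀ k ∈ K, y⁻¹ * k * y ∈ K) :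
    ∀ k ∈ K, y * k * y⁻¹ ∈ K := by
  have hcomp : CompactSpace U := isCompact_iff_compactSpace.1 hU
  let Z : Set U := ⋂ k ∈ K, {z : U | (z : G)⁻¹ * k * z ∈ K}
  have hZ : IsClosed Z := isClosed_biInter fun k _ => hK.preimage (by fun_prop)
  have hpow : ∀ n : ℕ, (⟨y, hy⟩ : U) ^ n ∈ Z := by
    intro n
    induction n with
    | zero => exact Set.mem_iInter₂.2 fun k hk => by simpa using hk
    | succ n ih =>
      refine Set.mem_iInter₂.2 fun k hk => ?_
      have := h _ (Set.mem_iInter₂.1 ih k hk)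
      simpa [pow_succ, mul_assoc] using this
  have hmem : (⟨y, hy⟩ : U)⁻¹ ∈ Z := by
    have h1 : (⟨y, hy⟩ : U)⁻¹ ∈ closure (Set.range fun n : ℤ => (⟨y, hy⟩ : U) ^ n) :=
      subset_closure ⟨-1, by simp⟩
    rw [closure_range_zpow_eq_pow] at h1
    exact closure_minimal (Set.range_subset_iff.2 hpow) hZ h1
  intro k hk
  simpa using Set.mem_iInter₂.1 hmem k hk

theorem exists_open_subgroup_conj_mem [TotallyDisconnectedSpace G] {U : Subgroup G}
    (hUc : IsCompact (U : Set G)) (hUo : IsOpen (U : Set G)) {A : Set G} (hA : A ∈ 𝓝 (1 : G)) :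
    ∃ W : Subgroup G, IsOpen (W : Set G) ∧ W ≤ U ∧ (∀ u ∈ U, ∀ w ∈ W, u * w * u⁻¹ ∈ W) ∧
      (W : Set G) ⊆ A := by
  have hcomp : CompactSpace U := isCompact_iff_compactSpace.1 hUc
  have hA' : ((↑) : U → G) ⁻¹' A ∈ 𝓝 (1 : U) :=
    continuous_subtype_val.continuousAt.preimage_mem_nhds hA
  obtain ⟨N, hN, hNo, hNA⟩ := exists_open_normal_le hA'
  refine ⟨N.map U.subtype, ?_, Subgroup.map_subtype_le _, ?_, ?_⟩
  · rw [Subgroup.coe_map]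
    exact hUo.isOpenEmbedding_subtypeVal.isOpenMap _ hNo
  · rintro u hu _ ⟨w, hw, rfl⟩
    exact ⟨⟨u, hu⟩ * w * ⟨u, hu⟩⁻¹, hN.conj_mem w hw _, rfl⟩
  · rintro _ ⟨w, hw, rfl⟩
    exact hNA hw

/-- Frattini argument: if `S` is a pro-`p` subgroup of `U` that satisfies Sylow's conjugacy
theorem in all closed subgroups between `S` and `U`, then every closed normal subgroup `N` of `G`
has a dense intersection with the local commensurator of `S`. -/
theorem exists_mul_mem_localCommensurator [T2Space G] [TotallyDisconnectedSpace G] {p : ℕ}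
    {U S : Subgroup G}
    (hUc : IsCompact (U : Set G)) (hUo : IsOpen (U : Set G)) (hSc : IsClosed (S : Set G))
    (hSU : S ≤ U) (hSp : ∀ s ∈ S, ∀ A ∈ 𝓝 (1 : G), ∃ k : ℕ, s ^ p ^ k ∈ A)
    (hconj : ∀ R T : Subgroup G, IsClosed (R : Set G) → S ≤ R → R ≤ U → T ≤ R →
      (∀ t ∈ T, ∀ A ∈ 𝓝 (1 : G), ∃ k : ℕ, t ^ p ^ k ∈ A) → ∃ y ∈ R, ∀ t ∈ T, y⁻¹ * t * y ∈ S)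
    {N : Subgroup G} [hN : N.Normal] (hNc : IsClosed (N : Set G)) {m : G} (hm : m ∈ N) {A : Set G}
    (hA : A ∈ 𝓝 (1 : G)) : ∃ u ∈ N, u ∈ A ∧ u * m ∈ localCommensurator S := by
  have hUcl : IsClosed (U : Set G) := hUc.isClosed
  have hScomp : IsCompact (S : Set G) := hUc.of_isClosed_subset hSc hSU
  obtain ⟨V, hVo, hVU, hVn, hVA⟩ := exists_open_subgroup_conj_mem hUc hUo (inv_mem_nhds_one G hA)
  have hVc : IsCompact (V : Set G) :=
    hUc.of_isClosed_subset (Subgroup.isClosed_of_isOpen _ hVo) hVU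
  -- conjugation of the Sylow subgroup `S ∩ W` by `m` only involves commutators in `N ∩ V`
  have hcomm : Tendsto (fun s => m * s * m⁻¹ * s⁻¹) (𝓝 1) (𝓝 1) := by
    have : Continuous fun s : G => m * s * m⁻¹ * s⁻¹ := by fun_prop
    simpa using this.tendsto 1
  obtain ⟨W, hWo, hWU, hWn, hWV⟩ := exists_open_subgroup_conj_mem hUc hUo
    (hcomm (hVo.mem_nhds (one_mem V)))
  have hnorm : S ≤ Subgroup.normalizer ((N ⊓ V : Subgroup G) : Set G) := by
    intro s hs
    rw [Subgroup.mem_normalizer_iff]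
    refine fun x => ⟨fun hx => ⟨hN.conj_mem x hx.1 s, hVn s (hSU hs) x hx.2⟩, fun hx => ?_⟩
    have h1 := hN.conj_mem _ hx.1 s⁻¹
    have h2 := hVn s⁻¹ (inv_mem (hSU hs)) _ hx.2
    simp only [mul_assoc, inv_mul_cancel_left, inv_inv, inv_mul_cancel, mul_one] at h1 h2
    exact ⟨h1, h2⟩
  have hR : (((N ⊓ V) ⊔ S : Subgroup G) : Set G) = ((N ⊓ V : Subgroup G) : Set G) * (S : Set G) :=
    Subgroup.coe_mul_of_right_le_normalizer_left _ _ hnorm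
  have hRc : IsClosed (((N ⊓ V) ⊔ S : Subgroup G) : Set G) := by
    rw [hR]
    exact ((hVc.inter_left hNc).mul hScomp).isClosed
  have hTR : (S ⊓ W).map (MulAut.conj m).toMonoidHom ≤ (N ⊓ V) ⊔ S := by
    rintro _ ⟨s, hs, rfl⟩
    have h1 : m * s * m⁻¹ * s⁻¹ ∈ N ⊓ V := by
      refine ⟨?_, hWV hs.2⟩
      have := mul_mem hm (hN.conj_mem _ (inv_mem hm) s)
      simpa [mul_assoc] using this
    have := Subgroup.mul_mem_sup h1 hs.1
    simpa using this
  have hTp : ∀ t ∈ (S ⊓ W).map (MulAut.conj m).toMonoidHom, ∀ B ∈ 𝓝 (1 : G),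
      ∃ k : ℕ, t ^ p ^ k ∈ B := by
    rintro _ ⟨s, hs, rfl⟩ B hB
    obtain ⟨k, hk⟩ := hSp s hs.1 _ (tendsto_conj_one m hB)
    refine ⟨k, ?_⟩
    rw [← map_pow]
    exact hk
  obtain ⟨y, hyR, hy⟩ := hconj _ _ hRc le_sup_right (sup_le (inf_le_right.trans hVU) hSU) hTR hTp
  have hyR' : y ∈ ((N ⊓ V : Subgroup G) : Set G) * (S : Set G) := hR ▸ hyR
  obtain ⟨u, hu, s₀, hs₀, rfl⟩ := hyR'
  -- the factor `s₀ ∈ S` of the conjugating element may be dropped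
  set g := u⁻¹ * m with hg
  have hgS : ∀ s ∈ S, s ∈ W → g * s * g⁻¹ ∈ S := by
    intro s hs hsW
    have h1 := hy _ ⟨s, ⟨hs, hsW⟩, rfl⟩
    have h2 := mul_mem (mul_mem hs₀ h1) (inv_mem hs₀)
    simpa [hg, mul_assoc] using h2
  refine ⟨u⁻¹, inv_mem hu.1, ?_, ?_⟩
  · simpa using hVA hu.2
  rw [mem_localCommensurator]
  constructor
  · filter_upwards [self_mem_nhdsWithin, mem_nhdsWithin_of_mem_nhds (hWo.mem_nhds (one_mem W))]
      with s hs hsW using hgS s hs hsW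
  -- `T` is a pro-`p` subgroup of `W` containing the Sylow subgroup `S ⊓ W` of `W`,
  -- hence equal to it
  let T : Subgroup G := W ⊓ S.comap (MulAut.conj g).toMonoidHom
  have hST : ∀ s ∈ S, s ∈ W → s ∈ T := fun s hs hsW => ⟨hsW, hgS s hs hsW⟩
  obtain ⟨z, hzU, hz⟩ := hconj U T hUcl hSU le_rfl (inf_le_left.trans hWU) (by
    rintro t ⟨-, ht⟩ B hB
    obtain ⟨k, hk⟩ := hSp _ ht _ (tendsto_conj_one' g hB)
    refine ⟨k, ?_⟩
    rw [← map_pow] at hk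
    simpa [mul_assoc] using hk)
  have hWn' : ∀ u ∈ U, ∀ w ∈ W, u⁻¹ * w * u ∈ W := fun u hu w hw => by
    simpa using hWn u⁻¹ (inv_mem hu) w hw
  have hSW : IsClosed ((S ⊓ W : Subgroup G) : Set G) :=
    hSc.inter (Subgroup.isClosed_of_isOpen _ hWo)
  have hz' := conj_mem_of_forall_conj_mem hUc hSW hzU fun k hk =>
    ⟨hz k (hST k hk.1 hk.2), hWn' z hzU k hk.2⟩
  have hTS : ∀ t ∈ T, t ∈ S := by
    intro t ht
    have := (hz' _ ⟨hz t ht, hWn' z hzU t ht.1⟩).1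
    simpa [mul_assoc] using this
  filter_upwards [self_mem_nhdsWithin, mem_nhdsWithin_of_mem_nhds
    (tendsto_conj_one' g (hWo.mem_nhds (one_mem W)))] with s hs hsW
  refine hTS _ ⟨hsW, ?_⟩
  have : g * (g⁻¹ * s * g) * g⁻¹ ∈ S := by simpa [mul_assoc] using hs
  exact this

end Commensurator

/-! ### Expansive monoliths -/

/-- If `B = X V` is symmetric and stable under left multiplication by `V`, then `V ⟨X⟩ ⊆ ⟨X⟩ V`. -/
theorem Subgroup.mul_mem_closure_mul {G : Type*} [Group G] {X : Set G} {V : Subgroup G} {B : Set G}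
    (hXB : X ⊆ B) (hB : B⁻¹ = B) (hVB : ∀ v ∈ V, ∀ b ∈ B, v * b ∈ B)
    (hBX : ∀ b ∈ B, ∃ x ∈ X, ∃ v ∈ V, b = x * v) {y : G} (hy : y ∈ Subgroup.closure X) :
    ∀ v ∈ V, ∃ y' ∈ Subgroup.closure X, ∃ v' ∈ V, v * y = y' * v' := by
  induction hy using Subgroup.closure_induction_left with
  | one => exact fun v hv => ⟨1, one_mem _, v, hv, by simp⟩
  | mul_left x hx y _ ih =>
    intro v hv
    obtain ⟨x', hx', v', hv', h⟩ := hBX _ (hVB v hv x (hXB hx))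
    obtain ⟨y', hy', v'', hv'', h'⟩ := ih v' hv'
    refine ⟨x' * y', mul_mem (Subgroup.subset_closure hx') hy', v'', hv'', ?_⟩
    rw [← mul_assoc, h, mul_assoc, h', mul_assoc]
  | inv_mul_cancel x hx y _ ih =>
    intro v hv
    have hxB : x⁻¹ ∈ B := by
      rw [← hB]
      exact Set.inv_mem_inv.2 (hXB hx)
    obtain ⟨x', hx', v', hv', h⟩ := hBX _ (hVB v hv _ hxB)
    obtain ⟨y', hy', v'', hv'', h'⟩ := ih v' hv'
    refine ⟨x' * y', mul_mem (Subgroup.subset_closure hx') hy', v'', hv'', ?_⟩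
    rw [← mul_assoc, h, mul_assoc, h', mul_assoc]

section Expansive

variable {G : Type*} [Group G] [TopologicalSpace G]

/-- Regional expansivity of a subgroup `M` of `G` in terms of subgroups of `G`. -/
theorem IsRegionallyExpansive.exists_core {M : Subgroup G} (hM : IsRegionallyExpansive M) :
    ∃ (O V : Subgroup G) (C : Set G), V ≤ O ∧ O ≤ M ∧ IsCompact C ∧ Subgroup.closure C = O ∧
      IsCompact (V : Set G) ∧ (∃ A ∈ 𝓝 (1 : G), A ∩ M ⊆ V) ∧
      ∀ k, (∀ o ∈ O, o⁻¹ * k * o ∈ V) → k = 1 := by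
  obtain ⟨O, hO, ⟨C, hCc, hC⟩, V, hVc, hVo, hcore⟩ := hM
  let f : O →* G := M.subtype.comp O.subtype
  have hf : Continuous f := continuous_subtype_val.comp continuous_subtype_val
  have hinj : Function.Injective f := M.subtype_injective.comp O.subtype_injective
  refine ⟨O.map M.subtype, V.map f, f '' C, ?_, Subgroup.map_subtype_le _, hCc.image hf, ?_,
    hVc.image hf, ?_, ?_⟩
  · rintro _ ⟨v, -, rfl⟩
    exact ⟨v, v.2, rfl⟩
  · rw [← MonoidHom.map_closure, hC, ← MonoidHom.range_eq_map, MonoidHom.range_comp,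
      Subgroup.range_subtype]
  · have h1 : f '' V = ((↑) : M → G) '' (((↑) : O → M) '' V) := by
      rw [Set.image_image]
      rfl
    have h2 : IsOpen (((↑) : O → M) '' V) := hO.isOpenEmbedding_subtypeVal.isOpenMap _ hVo
    obtain ⟨A, hA, hAV⟩ := isOpen_induced_iff.1 h2
    refine ⟨A, hA.mem_nhds ?_, ?_⟩
    · have : (1 : M) ∈ ((↑) : M → G) ⁻¹' A := hAV ▸ ⟨1, one_mem V, rfl⟩
      exact this
    · rintro x ⟨hxA, hxM⟩
      have : (⟨x, hxM⟩ : M) ∈ ((↑) : O → M) '' V := hAV ▸ hxA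
      obtain ⟨v, hv, h⟩ := this
      exact ⟨v, hv, congrArg Subtype.val h⟩
  · intro k hk
    obtain ⟨v, hv, h⟩ := hk 1 (one_mem _)
    have hvk : f v = k := by rw [h]; simp
    have : v ∈ V.normalCore := by
      intro o
      obtain ⟨w, hw, h'⟩ := hk (f o⁻¹) ⟨_, (o⁻¹).2, rfl⟩
      have : w = o * v * o⁻¹ := hinj (by rw [h', ← hvk]; simp)
      exact this ▸ hw
    rw [hcore, Subgroup.mem_bot] at this
    rw [← hvk, this, map_one]

variable [IsTopologicalGroup G]

/-- A closed normal subgroup of `G` that is the smallest non-trivial one, is not discrete and is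
regionally expansive. The monolith of a robustly monolithic group has these properties. -/
structure IsExpansiveMonolith (M : Subgroup G) : Prop where
  normal : M.Normal
  isClosed : IsClosed (M : Set G)
  le_of_normal : ∀ N : Subgroup G, N.Normal → IsClosed (N : Set G) → N ≠ ⊥ → M ≤ N
  not_discrete : ∀ W : Subgroup G, IsOpen (W : Set G) → W ⊓ M ≠ ⊥
  expansive : IsRegionallyExpansive M

end Expansive

section Monolith

variable {G : Type*} [Group G] [TopologicalSpace G] [NonarchimedeanGroup G]
  {M : Subgroup G}

/-- A compactly generated open subgroup `O` of `M` in which `W ⊓ M` has trivial core can be written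
as `⟨X⟩ (W ⊓ M)` with `X` a finite subset of a prescribed subgroup that is dense in `M`. -/
theorem IsExpansiveMonolith.exists_finset_eq_closure_mul (hM : IsExpansiveMonolith M)
    {D : Subgroup G} (hD : (M : Set G) ⊆ closure (D ⊓ M : Subgroup G)) :
    ∃ (X : Finset G) (W O : Subgroup G), (∀ x ∈ X, x ∈ D ⊓ M) ∧ IsOpen (W : Set G) ∧
      W ⊓ M ≤ O ∧ Subgroup.closure (X : Set G) ≤ O ∧
      (∀ o ∈ O, ∃ y ∈ Subgroup.closure (X : Set G), ∃ v ∈ W ⊓ M, o = y * v) ∧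
      ∀ k, (∀ o ∈ O, o⁻¹ * k * o ∈ W ⊓ M) → k = 1 := by
  classical
  obtain ⟨O, V, C, hVO, hOM, hCc, rfl, hVc, ⟨A, hA, hAV⟩, hcore⟩ := hM.expansive.exists_core
  obtain ⟨W, hWA⟩ := NonarchimedeanGroup.is_nonarchimedean A hA
  have hWV : (W : Subgroup G) ⊓ M ≤ V := fun x hx => hAV ⟨hWA hx.1, hx.2⟩
  have hWo : IsOpen ((W : Subgroup G) : Set G) := W.isOpen
  have hWMc : IsCompact (((W : Subgroup G) ⊓ M : Subgroup G) : Set G) :=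
    hVc.of_isClosed_subset (W.isClosed.inter hM.isClosed) hWV
  set V' : Subgroup G := (W : Subgroup G) ⊓ M
  set O := Subgroup.closure C
  have hV'O : V' ≤ O := hWV.trans hVO
  let C' : Set G := C ∪ C⁻¹ ∪ {1}
  let B : Set G := (V' : Set G) * C' * (V' : Set G)
  have hBc : IsCompact B := (hWMc.mul ((hCc.union hCc.inv).union isCompact_singleton)).mul hWMc
  have hC'O : C' ⊆ O := by
    rintro c ((hc | hc) | rfl)
    · exact Subgroup.subset_closure hc
    · simpa using inv_mem (Subgroup.subset_closure hc : c⁻¹ ∈ O)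
    · exact one_mem _
  have hBO : B ⊆ O := by
    rintro _ ⟨_, ⟨v, hv, c, hc, rfl⟩, v', hv', rfl⟩
    exact mul_mem (mul_mem (hV'O hv) (hC'O hc)) (hV'O hv')
  have hC'B : C' ⊆ B := fun c hc => ⟨c, ⟨1, one_mem V', c, hc, by simp⟩, 1, one_mem V', by simp⟩
  have hVB : ∀ v ∈ V', ∀ b ∈ B, v * b ∈ B := by
    rintro v hv _ ⟨_, ⟨w, hw, c, hc, rfl⟩, v', hv', rfl⟩
    exact ⟨_, ⟨v * w, mul_mem hv hw, c, hc, rfl⟩, v', hv', by simp [mul_assoc]⟩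
  have hBV : ∀ v ∈ V', ∀ b ∈ B, b * v ∈ B := by
    rintro v hv _ ⟨_, ⟨w, hw, c, hc, rfl⟩, v', hv', rfl⟩
    exact ⟨_, ⟨w, hw, c, hc, rfl⟩, v' * v, mul_mem hv' hv, by simp [mul_assoc]⟩
  have hBinv : B⁻¹ = B := by
    have h1 : C'⁻¹ = C' := by simp [C', Set.union_comm]
    simp only [B, mul_inv_rev, h1, inv_coe_set, mul_assoc]
  have hchoose : ∀ b ∈ B, ∃ x ∈ D ⊓ M, b⁻¹ * x ∈ W := by
    intro b hb
    have h1 : {x : G | b⁻¹ * x ∈ W} ∈ 𝓝 b :=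
      (continuous_const_mul b⁻¹).continuousAt.preimage_mem_nhds (by simpa using W.mem_nhds_one)
    obtain ⟨x, hx, hx'⟩ := mem_closure_iff_nhds.1 (hD (hOM (hBO hb))) _ h1
    exact ⟨x, hx', hx⟩
  choose! x hxD hxW using hchoose
  obtain ⟨t, htB, ht⟩ := hBc.elim_nhds_subcover (fun b => {g : G | b⁻¹ * g ∈ W}) fun b _ =>
    (continuous_const_mul b⁻¹).continuousAt.preimage_mem_nhds (by simpa using W.mem_nhds_one)
  have hxV : ∀ b ∈ B, b⁻¹ * x b ∈ V' := fun b hb =>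
    ⟨hxW b hb, M.mul_mem (M.inv_mem (hOM (hBO hb))) (hxD b hb).2⟩
  have hXB : ((t.image x : Finset G) : Set G) ⊆ B := by
    intro y hy
    obtain ⟨b, hb, rfl⟩ := Finset.mem_image.1 (Finset.mem_coe.1 hy)
    simpa using hBV _ (hxV b (htB b hb)) b (htB b hb)
  have hBX : ∀ b ∈ B, ∃ y ∈ ((t.image x : Finset G) : Set G), ∃ v ∈ V', b = y * v := by
    intro b hb
    obtain ⟨c, hc, hbc⟩ := Set.mem_iUnion₂.1 (ht hb)
    have hcB := htB c hc
    refine ⟨x c, by exact_mod_cast Finset.mem_image_of_mem x hc, (x c)⁻¹ * b, ?_, by simp⟩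
    have h1 : c⁻¹ * b ∈ V' := ⟨hbc, M.mul_mem (M.inv_mem (hOM (hBO hcB))) (hOM (hBO hb))⟩
    have := mul_mem (inv_mem (hxV c hcB)) h1
    simpa [mul_assoc] using this
  refine ⟨t.image x, W, O, ?_, hWo, hV'O, ?_, ?_, fun k hk => hcore k fun o ho => hWV (hk o ho)⟩
  · intro y hy
    obtain ⟨b, hb, rfl⟩ := Finset.mem_image.1 hy
    exact hxD b (htB b hb)
  · exact (Subgroup.closure_le _).2 (hXB.trans hBO)
  · intro o ho
    have step : ∀ b ∈ B, ∀ o, (∃ y ∈ Subgroup.closure ((t.image x : Finset G) : Set G),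
        ∃ v ∈ V', o = y * v) → ∃ y ∈ Subgroup.closure ((t.image x : Finset G) : Set G),
        ∃ v ∈ V', b * o = y * v := by
      rintro b hb _ ⟨y, hy, v, hv, rfl⟩
      obtain ⟨y₁, hy₁, v₁, hv₁, rfl⟩ := hBX b hb
      obtain ⟨y₂, hy₂, v₂, hv₂, h⟩ := Subgroup.mul_mem_closure_mul hXB hBinv hVB hBX hy v₁ hv₁
      refine ⟨y₁ * y₂, mul_mem (Subgroup.subset_closure hy₁) hy₂, v₂ * v, mul_mem hv₂ hv, ?_⟩
      rw [mul_assoc y₁, ← mul_assoc v₁, h]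
      simp only [mul_assoc]
    induction ho using Subgroup.closure_induction_left with
    | one => exact ⟨1, one_mem _, 1, one_mem _, by simp⟩
    | mul_left c hc o _ ih => exact step c (hC'B (Or.inl (Or.inl hc))) o ih
    | inv_mul_cancel c hc o _ ih =>
      exact step c⁻¹ (hC'B (Or.inl (Or.inr (by simpa using hc)))) o ih

/-- An abelian `M` would contain an open subgroup equal to its own core. -/
theorem IsExpansiveMonolith.centralizer_eq_bot [T2Space G] (hM : IsExpansiveMonolith M) :
    Subgroup.centralizer (M : Set G) = ⊥ := by
  by_contra h
  have hn := hM.normal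
  have hle : M ≤ Subgroup.centralizer (M : Set G) :=
    hM.le_of_normal _ inferInstance (Set.isClosed_centralizer _) h
  obtain ⟨O, V, C, hVO, hOM, -, -, -, ⟨A, hA, hAV⟩, hcore⟩ := hM.expansive.exists_core
  obtain ⟨W, hWA⟩ := NonarchimedeanGroup.is_nonarchimedean A hA
  refine hM.not_discrete W W.isOpen (eq_bot_iff.2 fun k hk => hcore k fun o ho => ?_)
  have h1 : o * k = k * o := Subgroup.mem_centralizer_iff.1 (hle hk.2) o (hOM ho)
  rw [mul_assoc, ← h1, inv_mul_cancel_left]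
  exact hAV ⟨hWA hk.1, hk.2⟩

/-- The closure of a non-trivial subgroup that is normalised by a dense subgroup contains `M`. -/
theorem IsExpansiveMonolith.subset_closure (hM : IsExpansiveMonolith M) {H D : Subgroup G}
    (hH : Dense (H : Set G)) (hD : ∀ h ∈ H, ∀ d ∈ D, h * d * h⁻¹ ∈ D) (hD1 : D ≠ ⊥) :
    (M : Set G) ⊆ closure (D : Set G) := by
  refine hM.le_of_normal D.topologicalClosure ⟨fun d hd g => ?_⟩ D.isClosed_topologicalClosure
    fun h => hD1 (eq_bot_iff.2 (h ▸ D.le_topologicalClosure))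
  have hcl : IsClosed {g : G | g * d * g⁻¹ ∈ D.topologicalClosure} :=
    D.isClosed_topologicalClosure.preimage (by fun_prop)
  have hsub : (H : Set G) ⊆ {g : G | g * d * g⁻¹ ∈ D.topologicalClosure} := fun h hh =>
    map_mem_closure (f := fun d => h * d * h⁻¹) (by fun_prop) hd (hD h hh)
  exact closure_minimal hsub hcl (hH g)

/-- The subgroup `M` has trivial quasi-centre. -/
theorem IsExpansiveMonolith.eq_one_of_eventually_commute (hM : IsExpansiveMonolith M) {m : G}
    (hm : m ∈ M) (h : ∀ᶠ x in 𝓝[M] 1, m * x = x * m) : m = 1 := by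
  have hMn := hM.normal
  let D : Subgroup G :=
    { carrier := {m | m ∈ M ∧ ∀ᶠ x in 𝓝[M] 1, m * x = x * m}
      one_mem' := ⟨one_mem M, by simp⟩
      mul_mem' := by
        rintro a b ⟨ha, ha'⟩ ⟨hb, hb'⟩
        refine ⟨mul_mem ha hb, ?_⟩
        filter_upwards [ha', hb'] with x h1 h2
        rw [mul_assoc, h2, ← mul_assoc, h1, mul_assoc]
      inv_mem' := by
        rintro a ⟨ha, ha'⟩
        refine ⟨inv_mem ha, ?_⟩
        filter_upwards [ha'] with x h1
        rw [inv_mul_eq_iff_eq_mul, ← mul_assoc, h1, mul_inv_cancel_right] }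
  have hDn : ∀ g ∈ (⊤ : Subgroup G), ∀ a ∈ D, g * a * g⁻¹ ∈ D := by
    refine fun g _ a ha => ⟨hMn.conj_mem a ha.1 g, ?_⟩
    have h1 : Tendsto (fun x => g⁻¹ * x * g) (𝓝[M] 1) (𝓝[M] 1) := by
      refine tendsto_nhdsWithin_iff.2 ⟨(tendsto_conj_one' g).mono_left nhdsWithin_le_nhds, ?_⟩
      filter_upwards [self_mem_nhdsWithin] with x hx
      simpa using hMn.conj_mem x hx g⁻¹
    filter_upwards [h1.eventually ha.2] with x hx
    have := congrArg (fun z => g * z * g⁻¹) hx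
    simpa [mul_assoc] using this
  by_contra hm1
  have hDM : D ≤ M := fun x hx => hx.1
  have hcl := hM.subset_closure (by simp) hDn fun h0 => hm1 (by
    have : m ∈ D := ⟨hm, h⟩
    rwa [h0, Subgroup.mem_bot] at this)
  obtain ⟨X, W, O, hX, hWo, hWO, hXO, hO, hcore⟩ :=
    hM.exists_finset_eq_closure_mul (D := D) (by rwa [inf_eq_left.2 hDM])
  -- all of `X` centralises a common open subgroup of `M`, which therefore is in the core
  have hev : ∀ᶠ x in 𝓝 (1 : G), x ∈ M → ∀ a ∈ X, a * x = x * a := by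
    have h1 : ∀ᶠ x in 𝓝[M] (1 : G), ∀ a ∈ X, a * x = x * a :=
      (Finset.eventually_all X).2 fun a ha => (hX a ha).1.2
    exact eventually_nhdsWithin_iff.1 h1
  obtain ⟨W', hW'⟩ := NonarchimedeanGroup.is_nonarchimedean _ hev
  refine hM.not_discrete (W ⊓ W') (hWo.inter W'.isOpen)
    (eq_bot_iff.2 fun k hk => hcore k fun o ho => ?_)
  obtain ⟨y, hy, v, hv, rfl⟩ := hO o ho
  have hyk : y * k = k * y := by
    have : Subgroup.closure (X : Set G) ≤ Subgroup.centralizer {k} :=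
      (Subgroup.closure_le _).2 fun a ha => by
        rw [SetLike.mem_coe, Subgroup.mem_centralizer_singleton_iff]
        exact hW' hk.1.2 hk.2 a ha
    exact Subgroup.mem_centralizer_singleton_iff.1 (this hy)
  have h1 : (y * v)⁻¹ * k * (y * v) = v⁻¹ * k * v := by
    rw [mul_inv_rev, mul_assoc, mul_assoc, ← mul_assoc k, ← hyk]
    simp [mul_assoc]
  rw [h1]
  exact mul_mem (mul_mem (inv_mem hv) ⟨hk.1.1, hk.2⟩) hv

/-- If `D ∩ M` is dense in `M`, then no small non-trivial subgroup of `G`, whether contained in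
`M` or not, is normalised by a suitable finite subset of `D ∩ M`. -/
theorem IsExpansiveMonolith.exists_finset_forall_eq_bot [T2Space G]
    (hM : IsExpansiveMonolith M)
    {D : Subgroup G} (hD : (M : Set G) ⊆ closure (D ⊓ M : Subgroup G)) :
    ∃ X : Finset G, (∀ x ∈ X, x ∈ D ⊓ M) ∧ ∃ W : Subgroup G, IsOpen (W : Set G) ∧
      ∀ K ≤ W, (∀ x ∈ X, x ∈ Subgroup.normalizer (K : Set G)) → K = ⊥ := by
  obtain ⟨X, W, O, hX, hWo, hWO, hXO, hO, hcore⟩ := hM.exists_finset_eq_closure_mul hD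
  have hMn := hM.normal
  refine ⟨X, hX, W, hWo, fun K hKW hKX => ?_⟩
  have hY : Subgroup.closure (X : Set G) ≤ Subgroup.normalizer (K : Set G) :=
    (Subgroup.closure_le _).2 hKX
  have hYM : Subgroup.closure (X : Set G) ≤ M := (Subgroup.closure_le _).2 fun x hx => (hX x hx).2
  have hconj : ∀ y ∈ Subgroup.closure (X : Set G), ∀ k ∈ K, y⁻¹ * k * y ∈ K := fun y hy k hk => by
    simpa using (Subgroup.mem_normalizer_iff.1 (hY (inv_mem hy)) k).1 hk
  -- `K ∩ M` lies in the core of `W ⊓ M`; so it is trivial, and `K` commutes with `⟨X⟩`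
  have hKM : ∀ k ∈ K, k ∈ M → k = 1 := by
    intro k hk hkM
    refine hcore k fun o ho => ?_
    obtain ⟨y, hy, v, hv, rfl⟩ := hO o ho
    have h1 : y⁻¹ * k * y ∈ W ⊓ M :=
      ⟨hKW (hconj y hy k hk), by simpa using hMn.conj_mem k hkM y⁻¹⟩
    have := mul_mem (mul_mem (inv_mem hv) h1) hv
    simpa [mul_assoc] using this
  have hcomm : ∀ k ∈ K, ∀ y ∈ Subgroup.closure (X : Set G), k * y = y * k := by
    intro k hk y hy
    have h1 : k⁻¹ * (y⁻¹ * k * y) = 1 := by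
      refine hKM _ (mul_mem (inv_mem hk) (hconj y hy k hk)) ?_
      have := mul_mem (hMn.conj_mem _ (inv_mem (hYM hy)) k⁻¹) (hYM hy)
      simpa [mul_assoc] using this
    rw [inv_mul_eq_one, mul_assoc, eq_inv_mul_iff_mul_eq] at h1
    exact h1.symm
  have hWM : ∀ k ∈ K, ∀ v ∈ W ⊓ M, k * v * k⁻¹ ∈ W ⊓ M := fun k hk v hv =>
    ⟨W.mul_mem (W.mul_mem (hKW hk) hv.1) (W.inv_mem (hKW hk)), hMn.conj_mem v hv.2 k⟩
  -- the commutators `[k, v]` lie in the core of `W ⊓ M`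
  have hcommW : ∀ k ∈ K, ∀ v ∈ W ⊓ M, k * v = v * k := by
    intro k hk v hv
    have h1 : k * v * k⁻¹ * v⁻¹ = 1 := by
      refine hcore _ fun o ho => ?_
      obtain ⟨y, hy, w, hw, rfl⟩ := hO o ho
      obtain ⟨y', hy', v', hv', h2⟩ :=
        hO (y⁻¹ * v⁻¹ * y) (mul_mem (mul_mem (inv_mem (hXO hy)) (inv_mem (hWO hv))) (hXO hy))
      have h3 : y⁻¹ * v * y = v'⁻¹ * y'⁻¹ := by
        rw [← mul_inv_rev, ← h2]
        simp [mul_assoc]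
      have h4 : y⁻¹ * (k * v * k⁻¹ * v⁻¹) * y = k * (y⁻¹ * v * y) * k⁻¹ * (y⁻¹ * v * y)⁻¹ := by
        have h5 := hcomm k hk _ (inv_mem hy)
        have h6 := hcomm k⁻¹ (inv_mem hk) y hy
        calc y⁻¹ * (k * v * k⁻¹ * v⁻¹) * y = (y⁻¹ * k) * v * k⁻¹ * v⁻¹ * y := by
              simp only [mul_assoc]
          _ = k * y⁻¹ * v * (y * (y⁻¹ * k⁻¹)) * v⁻¹ * y := by
              rw [← h5]; simp only [mul_assoc, mul_inv_cancel_left]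
          _ = k * y⁻¹ * v * (y * (k⁻¹ * y⁻¹)) * v⁻¹ * y := by
              rw [hcomm k⁻¹ (inv_mem hk) _ (inv_mem hy)]
          _ = _ := by simp only [mul_inv_rev, inv_inv, mul_assoc]
      have h5 : k * (v'⁻¹ * y'⁻¹) * k⁻¹ * (v'⁻¹ * y'⁻¹)⁻¹ = k * v'⁻¹ * k⁻¹ * v' := by
        have h6 := hcomm k⁻¹ (inv_mem hk) y' hy'
        calc k * (v'⁻¹ * y'⁻¹) * k⁻¹ * (v'⁻¹ * y'⁻¹)⁻¹
            = k * v'⁻¹ * y'⁻¹ * (k⁻¹ * y') * v' := by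
              simp only [mul_inv_rev, inv_inv, mul_assoc]
          _ = _ := by rw [h6]; simp only [mul_assoc, inv_mul_cancel_left]
      have h6 : y⁻¹ * (k * v * k⁻¹ * v⁻¹) * y ∈ W ⊓ M := by
        rw [h4, h3, h5]
        exact mul_mem (hWM k hk _ (inv_mem hv')) hv'
      have := mul_mem (mul_mem (inv_mem hw) h6) hw
      simpa [mul_assoc] using this
    rwa [mul_inv_eq_one, mul_inv_eq_iff_eq_mul] at h1
  -- so `[k, m]` is quasi-central in `M` for all `m ∈ M`
  refine eq_bot_iff.2 fun k hk => ?_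
  rw [← hM.centralizer_eq_bot, Subgroup.mem_centralizer_iff]
  intro m hm
  have h1 : k * (m * k⁻¹ * m⁻¹) = 1 := by
    refine hM.eq_one_of_eventually_commute ?_ ?_
    · have := mul_mem (hMn.conj_mem m hm k) (inv_mem hm)
      simpa [mul_assoc] using this
    · have hW1 : ∀ᶠ x in 𝓝[M] (1 : G), x ∈ W :=
        mem_nhdsWithin_of_mem_nhds (hWo.mem_nhds (one_mem W))
      have hW2 : ∀ᶠ x in 𝓝[M] (1 : G), m⁻¹ * x * m ∈ W :=
        mem_nhdsWithin_of_mem_nhds (tendsto_conj_one' m (hWo.mem_nhds (one_mem W)))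
      filter_upwards [self_mem_nhdsWithin, hW1, hW2] with x hxM hxW hxW'
      have h2 := hcommW k hk x ⟨hxW, hxM⟩
      have h3 := hcommW k⁻¹ (inv_mem hk) (m⁻¹ * x * m)
        ⟨hxW', by simpa using hMn.conj_mem x hxM m⁻¹⟩
      calc k * (m * k⁻¹ * m⁻¹) * x = k * m * (k⁻¹ * (m⁻¹ * x * m)) * m⁻¹ := by
            simp [mul_assoc]
        _ = (k * x) * (m * k⁻¹ * m⁻¹) := by rw [h3]; simp [mul_assoc]
        _ = x * (k * (m * k⁻¹ * m⁻¹)) := by rw [h2]; simp [mul_assoc]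
  have h2 : k * m = m * k := by
    have := congrArg (fun z => z * m * k) h1
    simpa [mul_assoc] using this
  exact h2.symm

end Monolith

/-! ### Germ centralisers and closures in the local commensurator -/

/-- Finitely many normal abelian subgroups of a group centralise a common non-trivial normal
subgroup: if `⁅B, A⁆ ≠ ⊥` for one of them, replace `B` by `⁅B, A⁆ ≤ A`. -/
theorem Subgroup.exists_normal_commutator_eq_bot {T ι : Type*} [Group T] [Nontrivial T]
    (A : ι → Subgroup T) (hA : ∀ i, (A i).Normal) (hAc : ∀ i, ⁅A i, A i⁆ = ⊥) (F : Finset ι) :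
    ∃ B : Subgroup T, B.Normal ∧ B ≠ ⊥ ∧ ∀ i ∈ F, ⁅B, A i⁆ = ⊥ := by
  classical
  induction F using Finset.induction_on with
  | empty => exact ⟨⊤, inferInstance, top_ne_bot, by simp⟩
  | insert i F _ ih =>
    obtain ⟨B, hBn, hB, hBF⟩ := ih
    have hAi := hA i
    by_cases h : ⁅B, A i⁆ = ⊥
    · refine ⟨B, hBn, hB, fun j hj => ?_⟩
      rcases Finset.mem_insert.1 hj with rfl | hj
      · exact h
      · exact hBF j hj
    · refine ⟨⁅B, A i⁆, inferInstance, h, fun j hj => ?_⟩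
      rcases Finset.mem_insert.1 hj with rfl | hj
      · exact eq_bot_iff.2 ((Subgroup.commutator_mono (Subgroup.commutator_le_right B (A j))
          le_rfl).trans (hAc j).le)
      · exact eq_bot_iff.2 ((Subgroup.commutator_mono (Subgroup.commutator_le_left B (A i))
          le_rfl).trans (hBF j hj).le)

theorem Subgroup.mem_normalizer_of_forall_commute {G : Type*} [Group G] {K : Subgroup G} {x : G}
    (h : ∀ k ∈ K, x * k = k * x) : x ∈ Subgroup.normalizer (K : Set G) :=
  Subgroup.centralizer_le_normalizer (K : Set G)
    (Subgroup.mem_centralizer_iff.2 fun k hk => (h k hk).symm)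

theorem Subgroup.mem_normalizer_of_forall_conj_mem {G : Type*} [Group G] {K : Subgroup G} {x : G}
    (h : ∀ k ∈ K, x * k * x⁻¹ ∈ K) (h' : ∀ k ∈ K, x⁻¹ * k * x ∈ K) :
    x ∈ Subgroup.normalizer (K : Set G) :=
  Subgroup.mem_normalizer_iff.2 fun k => ⟨h k, fun hk => by
    simpa [mul_assoc] using h' _ hk⟩

section

variable {G : Type*} [Group G] [TopologicalSpace G]

/-- The elements of the local commensurator of `S` that centralise, for all `h ∈ F`, the elements of
`h L h⁻¹` close to `1`. -/
def germCentralizer (S L : Subgroup G) (F : Finset G) : Subgroup G where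
  carrier := {g | g ∈ localCommensurator S ∧
    ∀ h ∈ F, ∀ᶠ x in 𝓝 (1 : G), h⁻¹ * x * h ∈ L → g * x = x * g}
  one_mem' := ⟨one_mem _, by simp⟩
  mul_mem' := by
    rintro a b ⟨ha, ha'⟩ ⟨hb, hb'⟩
    refine ⟨mul_mem ha hb, fun h hh => ?_⟩
    filter_upwards [ha' h hh, hb' h hh] with x h1 h2 hx
    rw [mul_assoc, h2 hx, ← mul_assoc, h1 hx, mul_assoc]
  inv_mem' := by
    rintro a ⟨ha, ha'⟩
    refine ⟨inv_mem ha, fun h hh => ?_⟩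
    filter_upwards [ha' h hh] with x h1 hx
    rw [inv_mul_eq_iff_eq_mul, ← mul_assoc, h1 hx, mul_inv_cancel_right]

theorem germCentralizer_le (S L : Subgroup G) (F : Finset G) :
    germCentralizer S L F ≤ localCommensurator S := fun _ hg => hg.1

theorem germCentralizer_anti (S L : Subgroup G) {F F' : Finset G} (h : F ⊆ F') :
    germCentralizer S L F' ≤ germCentralizer S L F := fun _ hg =>
  ⟨hg.1, fun a ha => hg.2 a (h ha)⟩

theorem conj_mem_germCentralizer [IsTopologicalGroup G] {S L : Subgroup G} {F F' : Finset G} {g : G}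
    (hg : g ∈ localCommensurator S) (hF : ∀ h ∈ F', g⁻¹ * h ∈ F) {q : G}
    (hq : q ∈ germCentralizer S L F) : g * q * g⁻¹ ∈ germCentralizer S L F' := by
  refine ⟨mul_mem (mul_mem hg hq.1) (inv_mem hg), fun h hh => ?_⟩
  filter_upwards [(tendsto_conj_one' g).eventually (hq.2 _ (hF h hh))] with x hx hxL
  have h1 := hx (by simpa [mul_assoc] using hxL)
  have := congrArg (fun z => g * z * g⁻¹) h1
  simpa [mul_assoc] using this

end

section Local

variable {G : Type*} [Group G] [TopologicalSpace G] [NonarchimedeanGroup G]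

theorem exists_open_subgroup_subset {A : Set G} (hA : A ∈ 𝓝 (1 : G)) :
    ∃ W : Subgroup G, IsOpen (W : Set G) ∧ (W : Set G) ⊆ A := by
  obtain ⟨W, hW⟩ := NonarchimedeanGroup.is_nonarchimedean A hA
  exact ⟨W, W.isOpen, hW⟩

theorem eventually_conj_mem {S : Subgroup G} {h : G} (hh : h ∈ localCommensurator S) :
    ∀ᶠ x in 𝓝 (1 : G), x ∈ S → h⁻¹ * x * h ∈ S :=
  eventually_nhdsWithin_iff.1 (mem_localCommensurator.1 hh).2

theorem eventually_mem_of_conj_mem {S : Subgroup G} {h : G} (hh : h ∈ localCommensurator S) :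
    ∀ᶠ x in 𝓝 (1 : G), h⁻¹ * x * h ∈ S → x ∈ S := by
  filter_upwards [(tendsto_conj_one' h).eventually
    (eventually_nhdsWithin_iff.1 (mem_localCommensurator.1 hh).1)] with x hx hxS
  simpa [mul_assoc] using hx hxS

/-- The closure of a subgroup `Q` of the local commensurator `H` of `S` in the group topology on
`H` for which `S`, with its topology as a subspace of `G`, is an open subgroup. -/
def localClosure (S Q : Subgroup G) (hQ : Q ≤ localCommensurator S) : Subgroup G where
  carrier := {g | ∀ W : Subgroup G, IsOpen (W : Set G) → ∃ s ∈ S ⊓ W, g * s ∈ Q}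
  one_mem' := fun W _ => ⟨1, one_mem _, by simp⟩
  mul_mem' := by
    intro a b ha hb W hW
    obtain ⟨t, ht, hbt⟩ := hb W hW
    have hbH : b ∈ localCommensurator S := by
      have := mul_mem (hQ hbt) (inv_mem (le_localCommensurator S ht.1))
      simpa using this
    have hev : ∀ᶠ x in 𝓝 (1 : G), b⁻¹ * x * b ∈ W ∧ (x ∈ S → b⁻¹ * x * b ∈ S) :=
      ((tendsto_conj_one' b).eventually (hW.mem_nhds (one_mem W))).and (eventually_conj_mem hbH)
    obtain ⟨W', hW'o, hW'⟩ := exists_open_subgroup_subset hev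
    obtain ⟨s, hs, has⟩ := ha W' hW'o
    refine ⟨b⁻¹ * s * b * t, mul_mem ⟨(hW' hs.2).2 hs.1, (hW' hs.2).1⟩ ht, ?_⟩
    simpa [mul_assoc] using mul_mem has hbt
  inv_mem' := by
    intro a ha W hW
    obtain ⟨t, ht, hat⟩ := ha W hW
    have haH : a⁻¹ ∈ localCommensurator S := by
      have := mul_mem (hQ hat) (inv_mem (le_localCommensurator S ht.1))
      exact inv_mem (by simpa using this)
    have hev : ∀ᶠ x in 𝓝 (1 : G), a * x * a⁻¹ ∈ W ∧ (x ∈ S → a * x * a⁻¹ ∈ S) :=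
      ((tendsto_conj_one a).eventually (hW.mem_nhds (one_mem W))).and
        (by simpa using eventually_conj_mem haH)
    obtain ⟨W', hW'o, hW'⟩ := exists_open_subgroup_subset hev
    obtain ⟨s, hs, has⟩ := ha W' hW'o
    refine ⟨a * s⁻¹ * a⁻¹, ⟨(hW' (inv_mem hs.2)).2 (inv_mem hs.1), (hW' (inv_mem hs.2)).1⟩, ?_⟩
    simpa [mul_assoc] using inv_mem has

theorem le_localClosure {S Q : Subgroup G} (hQ : Q ≤ localCommensurator S) :
    Q ≤ localClosure S Q hQ := fun q hq _ _ => ⟨1, one_mem _, by simpa using hq⟩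

theorem localClosure_mono {S Q Q' : Subgroup G} (hQ : Q ≤ localCommensurator S)
    (hQ' : Q' ≤ localCommensurator S) (h : Q ≤ Q') :
    localClosure S Q hQ ≤ localClosure S Q' hQ' := fun _ hg W hW =>
  (hg W hW).imp fun _ hs => ⟨hs.1, h hs.2⟩

theorem conj_mem_localClosure {S Q Q' : Subgroup G} (hQ : Q ≤ localCommensurator S)
    (hQ' : Q' ≤ localCommensurator S) {h : G} (hh : h ∈ localCommensurator S)
    (hconj : ∀ q ∈ Q, h * q * h⁻¹ ∈ Q') {g : G} (hg : g ∈ localClosure S Q hQ) :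
    h * g * h⁻¹ ∈ localClosure S Q' hQ' := by
  intro W hW
  have hev : ∀ᶠ x in 𝓝 (1 : G), h * x * h⁻¹ ∈ W ∧ (x ∈ S → h * x * h⁻¹ ∈ S) :=
    ((tendsto_conj_one h).eventually (hW.mem_nhds (one_mem W))).and
      (by simpa using eventually_conj_mem (inv_mem hh))
  obtain ⟨W', hW'o, hW'⟩ := exists_open_subgroup_subset hev
  obtain ⟨s, hs, hgs⟩ := hg W' hW'o
  refine ⟨h * s * h⁻¹, ⟨(hW' hs.2).2 hs.1, (hW' hs.2).1⟩, ?_⟩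
  simpa [mul_assoc] using hconj _ hgs

/-- For `x` in the local commensurator, the part of the local closure of `Q` in the compact set
`x (S ∩ W) x⁻¹ \ (S ∩ W)` is closed in `G`: the two topologies agree on `x (S ∩ W) x⁻¹`. -/
theorem isClosed_localClosure_inter_conj {S Q : Subgroup G} (hQ : Q ≤ localCommensurator S)
    (hS : IsClosed (S : Set G)) {x : G} (hx : x ∈ localCommensurator S) {W : Subgroup G}
    (hW : IsOpen (W : Set G)) :
    IsClosed {g : G | g ∈ localClosure S Q hQ ∧ x⁻¹ * g * x ∈ S ⊓ W ∧ g ∉ S ⊓ W} := by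
  refine isClosed_of_closure_subset fun g hg => ?_
  have hSW : IsClosed {g : G | x⁻¹ * g * x ∈ S ⊓ W} :=
    (hS.inter (Subgroup.isClosed_of_isOpen _ hW)).preimage (f := fun g => x⁻¹ * g * x)
      (by fun_prop)
  have hgx : x⁻¹ * g * x ∈ S ⊓ W := closure_minimal (fun c hc => hc.2.1) hSW hg
  -- nearby points of the set differ by elements of `S`
  have key : ∀ W' : Subgroup G, IsOpen (W' : Set G) → ∃ c, (c ∈ localClosure S Q hQ ∧
      x⁻¹ * c * x ∈ S ⊓ W ∧ c ∉ S ⊓ W) ∧ c⁻¹ * g ∈ S ⊓ W ∧ c⁻¹ * g ∈ W' := by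
    intro W' hW'
    have hev : ∀ᶠ d in 𝓝 (1 : G), d ∈ W ∧ d ∈ W' ∧ (x⁻¹ * d * x ∈ S → d ∈ S) :=
      Filter.Eventually.and (hW.mem_nhds (one_mem W))
        (Filter.Eventually.and (hW'.mem_nhds (one_mem W')) (eventually_mem_of_conj_mem hx))
    have hcont : Tendsto (fun c : G => c⁻¹ * g) (𝓝 g) (𝓝 1) := by
      have : Continuous fun c : G => c⁻¹ * g := by fun_prop
      simpa using this.tendsto g
    obtain ⟨c, hc, hcZ⟩ := mem_closure_iff_nhds.1 hg _ (hcont.eventually hev)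
    refine ⟨c, hcZ, ⟨hc.2.2 ?_, hc.1⟩, hc.2.1⟩
    have := S.mul_mem (S.inv_mem hcZ.2.1.1) hgx.1
    simpa [mul_assoc] using this
  refine ⟨fun W' hW' => ?_, hgx, fun hgSW => ?_⟩
  · obtain ⟨c, ⟨hc, -⟩, hd, hdW'⟩ := key W' hW'
    obtain ⟨s, hs, hcs⟩ := hc W' hW'
    exact ⟨(c⁻¹ * g)⁻¹ * s, mul_mem (inv_mem ⟨hd.1, hdW'⟩) hs, by simpa [mul_assoc] using hcs⟩
  · obtain ⟨c, ⟨-, -, hc⟩, hd, -⟩ := key ⊤ isOpen_univ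
    refine hc ?_
    simpa using mul_mem hgSW (inv_mem hd)

/-- The germ centraliser of the conjugates `h L h⁻¹` with `h ∈ F` is normalised by each of them:
since `S` normalises `L`, conjugating a small `x` by an element of `h L h⁻¹` changes it by a small
element of `h L h⁻¹`. -/
theorem conj_mem_germCentralizer_of_mem {S L : Subgroup G} (hLS : L ≤ S)
    (hL : ∀ s ∈ S, ∀ l ∈ L, s * l * s⁻¹ ∈ L) {F : Finset G}
    (hF : ∀ h ∈ F, h ∈ localCommensurator S) {h : G} (hh : h ∈ F) {l : G} (hl : l ∈ L) {q : G}
    (hq : q ∈ germCentralizer S L F) :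
    h * l * h⁻¹ * q * (h * l * h⁻¹)⁻¹ ∈ germCentralizer S L F := by
  have hhH := hF h hh
  set a := h * l * h⁻¹ with ha
  have haH : a ∈ localCommensurator S :=
    mul_mem (mul_mem hhH (le_localCommensurator S (hLS hl))) (inv_mem hhH)
  refine ⟨mul_mem (mul_mem haH hq.1) (inv_mem haH), fun j hj => ?_⟩
  have htend : Tendsto (fun x => a⁻¹ * x * a * x⁻¹) (𝓝 1) (𝓝 1) := by
    have : Continuous fun x : G => a⁻¹ * x * a * x⁻¹ := by fun_prop
    simpa using this.tendsto 1
  filter_upwards [hq.2 j hj, htend.eventually (hq.2 h hh), eventually_conj_mem hhH,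
    eventually_mem_of_conj_mem (hF j hj)] with x h1 h2 h3 h4 hxL
  have hxS : h⁻¹ * x * h ∈ S := h3 (h4 (hLS hxL))
  have h5 : q * x = x * q := h1 hxL
  have h6 : q * (a⁻¹ * x * a * x⁻¹) = a⁻¹ * x * a * x⁻¹ * q := by
    refine h2 ?_
    have := mul_mem (inv_mem hl) (hL _ hxS l hl)
    simpa [ha, mul_assoc] using this
  have h7 : q * (a⁻¹ * x * a) = a⁻¹ * x * a * q := by
    calc q * (a⁻¹ * x * a) = q * (a⁻¹ * x * a * x⁻¹) * x := by simp [mul_assoc]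
      _ = a⁻¹ * x * a * x⁻¹ * (q * x) := by rw [h6]; simp [mul_assoc]
      _ = _ := by rw [h5]; simp [mul_assoc]
  have := congrArg (fun z => a * z * a⁻¹) h7
  simpa [mul_assoc] using this

/-- Germ centralisers of an abelian normal subgroup `L` of `S` are not discrete. -/
theorem exists_mem_germCentralizer_ne_one {S L : Subgroup G} (hLS : L ≤ S)
    (hL : ∀ s ∈ S, ∀ l ∈ L, s * l * s⁻¹ ∈ L) (hLc : ∀ a ∈ L, ∀ b ∈ L, a * b = b * a)
    (hS : ∀ W : Subgroup G, IsOpen (W : Set G) → S ⊓ W ≠ ⊥) {F : Finset G}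
    (hF : ∀ h ∈ F, h ∈ localCommensurator S) {W : Subgroup G} (hW : IsOpen (W : Set G)) :
    ∃ z ∈ germCentralizer S L F, z ∈ S ⊓ W ∧ z ≠ 1 := by
  have hev : ∀ᶠ x in 𝓝 (1 : G), x ∈ W ∧ ∀ h ∈ F,
      (h⁻¹ * x * h ∈ S → x ∈ S) ∧ (x ∈ S → h⁻¹ * x * h ∈ S) :=
    Filter.Eventually.and (hW.mem_nhds (one_mem W)) ((Finset.eventually_all F).2 fun h hh =>
      (eventually_mem_of_conj_mem (hF h hh)).and (eventually_conj_mem (hF h hh)))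
  obtain ⟨V, hVo, hV⟩ := exists_open_subgroup_subset hev
  -- inside `T = S ⊓ V` the conjugates `h L h⁻¹` with `h ∈ F` induce abelian normal subgroups
  let T : Subgroup G := S ⊓ V
  have hT : Nontrivial T := (Subgroup.nontrivial_iff_ne_bot T).2 (hS V hVo)
  let A : F → Subgroup T := fun h =>
    L.comap ((MulAut.conj (h : G)⁻¹).toMonoidHom.comp T.subtype)
  have hAmem : ∀ (h : F) (t : T), t ∈ A h ↔ (h : G)⁻¹ * t * h ∈ L := fun h t => by
    simp [A]
  have hAn : ∀ h, (A h).Normal := by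
    refine fun h => ⟨fun t ht s => ?_⟩
    rw [hAmem] at ht ⊢
    have := hL _ (((hV s.2.2).2 h h.2).2 s.2.1) _ ht
    simpa [mul_assoc] using this
  have hAc : ∀ h, ⁅A h, A h⁆ = ⊥ := by
    intro h
    rw [Subgroup.commutator_eq_bot_iff_le_centralizer]
    intro t ht
    refine Subgroup.mem_centralizer_iff.2 fun s hs => ?_
    have := hLc _ ((hAmem h s).1 hs) _ ((hAmem h t).1 ht)
    ext
    have := congrArg (fun z => (h : G) * z * (h : G)⁻¹) this
    simpa [mul_assoc] using this
  obtain ⟨B, -, hB, hBA⟩ := Subgroup.exists_normal_commutator_eq_bot A hAn hAc Finset.univ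
  obtain ⟨z, hz, hz1⟩ := B.bot_or_exists_ne_one.resolve_left hB
  refine ⟨z, ⟨le_localCommensurator S z.2.1, fun h hh => ?_⟩, ⟨z.2.1, (hV z.2.2).1⟩,
    fun h => hz1 (Subtype.ext h)⟩
  filter_upwards [hVo.mem_nhds (one_mem V)] with x hxV hxL
  have hxT : x ∈ T := ⟨((hV hxV).2 h hh).1 (hLS hxL), hxV⟩
  have h1 := Subgroup.commutator_eq_bot_iff_le_centralizer.1 (hBA ⟨h, hh⟩ (Finset.mem_univ _)) hz
  have h2 := Subgroup.mem_centralizer_iff.1 h1 ⟨x, hxT⟩ ((hAmem ⟨h, hh⟩ ⟨x, hxT⟩).2 hxL)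
  exact (congrArg Subtype.val h2).symm

end Local

/-! ### Abelian normal subgroups -/

theorem Subgroup.exists_finset_mem_closure_biUnion {G ι : Type*} [Group G] [DecidableEq ι]
    {A : ι → Set G} {I : Set ι} {x : G} (hx : x ∈ Subgroup.closure (⋃ i ∈ I, A i)) :
    ∃ F : Finset ι, (∀ i ∈ F, i ∈ I) ∧ x ∈ Subgroup.closure (⋃ i ∈ F, A i) := by
  have hmono : ∀ F F' : Finset ι, F ⊆ F' →
      Subgroup.closure (⋃ i ∈ F, A i) ≤ Subgroup.closure (⋃ i ∈ F', A i) := fun F F' h =>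
    Subgroup.closure_mono (Set.biUnion_subset_biUnion_left h)
  induction hx using Subgroup.closure_induction with
  | mem x hx =>
    obtain ⟨i, hi, hxi⟩ := Set.mem_iUnion₂.1 hx
    refine ⟨{i}, by simpa using hi, Subgroup.subset_closure (by simpa using hxi)⟩
  | one => exact ⟨∅, by simp, one_mem _⟩
  | mul x y _ _ ihx ihy =>
    obtain ⟨F, hF, hx⟩ := ihx
    obtain ⟨F', hF', hy⟩ := ihy
    refine ⟨F ∪ F', fun i hi => (Finset.mem_union.1 hi).elim (hF i) (hF' i), mul_mem ?_ ?_⟩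
    · exact hmono _ _ Finset.subset_union_left hx
    · exact hmono _ _ Finset.subset_union_right hy
  | inv x _ ih =>
    obtain ⟨F, hF, hx⟩ := ih
    exact ⟨F, hF, inv_mem hx⟩

section LocallyNormal

variable {G : Type*} [Group G] [TopologicalSpace G] [NonarchimedeanGroup G] [T2Space G]
  {M S : Subgroup G}

/-- A non-trivial subgroup normalised by the local commensurator of `S` is dense in `M`. -/
theorem IsExpansiveMonolith.subset_closure_inf (hM : IsExpansiveMonolith M)
    (hH : Dense (localCommensurator S : Set G))
    (hHM : (M : Set G) ⊆ closure (localCommensurator S ⊓ M : Subgroup G)) {D : Subgroup G}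
    (hD : ∀ h ∈ localCommensurator S, ∀ d ∈ D, h * d * h⁻¹ ∈ D) (hD1 : D ≠ ⊥) :
    (M : Set G) ⊆ closure (D ⊓ M : Subgroup G) := by
  have hMn := hM.normal
  refine hM.subset_closure hH (fun h hh d hd => ⟨hD h hh d hd.1, hMn.conj_mem d hd.2 h⟩)
    fun hbot => hD1 (eq_bot_iff.2 fun d hd => ?_)
  -- if `D ∩ M` is trivial, then `D` commutes with the normal subgroup `H ∩ M`, hence with `M`
  rw [← hM.centralizer_eq_bot, Subgroup.mem_centralizer_iff]
  have hcl : IsClosed {m : G | m * d = d * m} := isClosed_eq (by fun_prop) (by fun_prop)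
  refine fun m hm => closure_minimal ?_ hcl (hHM hm)
  rintro x ⟨hxH, hxM⟩
  have h1 : x * d * x⁻¹ * d⁻¹ ∈ D ⊓ M := by
    refine ⟨D.mul_mem (hD x hxH d hd) (D.inv_mem hd), ?_⟩
    have := M.mul_mem hxM (hMn.conj_mem _ (M.inv_mem hxM) d)
    simpa [mul_assoc] using this
  rw [hbot, Subgroup.mem_bot, mul_inv_eq_one, mul_inv_eq_iff_eq_mul] at h1
  exact h1

/-- The local commensurator of `S` has trivial quasi-centre for the topology in which `S` is open.
-/
theorem IsExpansiveMonolith.eq_one_of_eventually_commute_nhdsWithin (hM : IsExpansiveMonolith M)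
    (hH : Dense (localCommensurator S : Set G))
    (hHM : (M : Set G) ⊆ closure (localCommensurator S ⊓ M : Subgroup G))
    (hS : ∀ W : Subgroup G, IsOpen (W : Set G) → S ⊓ W ≠ ⊥)
    {g : G} (hg : g ∈ localCommensurator S) (h : ∀ᶠ x in 𝓝[S] 1, g * x = x * g) : g = 1 := by
  let D : Subgroup G :=
    { carrier := {g | g ∈ localCommensurator S ∧ ∀ᶠ x in 𝓝[S] 1, g * x = x * g}
      one_mem' := ⟨one_mem _, by simp⟩
      mul_mem' := by
        rintro a b ⟨ha, ha'⟩ ⟨hb, hb'⟩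
        refine ⟨mul_mem ha hb, ?_⟩
        filter_upwards [ha', hb'] with x h1 h2
        rw [mul_assoc, h2, ← mul_assoc, h1, mul_assoc]
      inv_mem' := by
        rintro a ⟨ha, ha'⟩
        refine ⟨inv_mem ha, ?_⟩
        filter_upwards [ha'] with x h1
        rw [inv_mul_eq_iff_eq_mul, ← mul_assoc, h1, mul_inv_cancel_right] }
  have hDn : ∀ h ∈ localCommensurator S, ∀ a ∈ D, h * a * h⁻¹ ∈ D := by
    refine fun h hh a ha => ⟨mul_mem (mul_mem hh ha.1) (inv_mem hh), ?_⟩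
    filter_upwards [hh.2.eventually ha.2] with x hx
    have := congrArg (fun z => h * z * h⁻¹) hx
    simpa [mul_assoc] using this
  by_contra hg1
  have hcl := hM.subset_closure_inf hH hHM hDn fun h0 => hg1 (by
    have : g ∈ D := ⟨hg, h⟩
    rwa [h0, Subgroup.mem_bot] at this)
  obtain ⟨X, hX, W, hWo, hW⟩ := hM.exists_finset_forall_eq_bot hcl
  have hev : ∀ᶠ x in 𝓝 (1 : G), x ∈ S → ∀ a ∈ X, a * x = x * a := by
    have h1 : ∀ᶠ x in 𝓝[S] (1 : G), ∀ a ∈ X, a * x = x * a :=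
      (Finset.eventually_all X).2 fun a ha => (hX a ha).1.2
    exact eventually_nhdsWithin_iff.1 h1
  obtain ⟨W', hW'o, hW'⟩ := exists_open_subgroup_subset hev
  refine hS (W ⊓ W') (hWo.inter hW'o) (hW _ (inf_le_right.trans inf_le_left) fun x hx => ?_)
  exact Subgroup.mem_normalizer_of_forall_commute fun k hk => hW' hk.2.2 hk.1 x hx

/-- A discrete normal subgroup `L` of `S` is trivial: for `l ∈ L`, the commutators of `l` with small
elements of `S` are small elements of `L`, so they are trivial. -/
theorem IsExpansiveMonolith.eq_bot_of_discrete (hM : IsExpansiveMonolith M)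
    (hH : Dense (localCommensurator S : Set G))
    (hHM : (M : Set G) ⊆ closure (localCommensurator S ⊓ M : Subgroup G))
    (hS : ∀ W : Subgroup G, IsOpen (W : Set G) → S ⊓ W ≠ ⊥) {L : Subgroup G} (hLS : L ≤ S)
    (hL : ∀ s ∈ S, ∀ l ∈ L, s * l * s⁻¹ ∈ L) (h : ∀ᶠ x in 𝓝 (1 : G), x ∈ L → x = 1) : L = ⊥ := by
  refine eq_bot_iff.2 fun l hl => hM.eq_one_of_eventually_commute_nhdsWithin hH hHM hS
    (le_localCommensurator S (hLS hl)) ?_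
  have htend : Tendsto (fun x => x * l * x⁻¹ * l⁻¹) (𝓝[S] 1) (𝓝 1) := by
    have : Continuous fun x : G => x * l * x⁻¹ * l⁻¹ := by fun_prop
    simpa using (this.tendsto 1).mono_left (nhdsWithin_le_nhds (s := (S : Set G)))
  filter_upwards [self_mem_nhdsWithin, htend.eventually h] with x hx h1
  have h2 := h1 (mul_mem (hL x hx l hl) (inv_mem hl))
  rw [mul_inv_eq_one, mul_inv_eq_iff_eq_mul] at h2
  exact h2.symm

/-- An abelian normal subgroup of `S` is trivial. The hypothesis `hbasis` provides arbitrarily small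
open subgroups normalised by `S`. -/
theorem IsExpansiveMonolith.eq_bot_of_commute (hM : IsExpansiveMonolith M)
    (hSc : IsCompact (S : Set G))
    (hbasis : ∀ A ∈ 𝓝 (1 : G), ∃ W : Subgroup G, IsOpen (W : Set G) ∧
      (∀ s ∈ S, ∀ w ∈ W, s * w * s⁻¹ ∈ W) ∧ (W : Set G) ⊆ A)
    (hH : Dense (localCommensurator S : Set G))
    (hHM : (M : Set G) ⊆ closure (localCommensurator S ⊓ M : Subgroup G))
    (hS : ∀ W : Subgroup G, IsOpen (W : Set G) → S ⊓ W ≠ ⊥) {L : Subgroup G} (hLS : L ≤ S)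
    (hL : ∀ s ∈ S, ∀ l ∈ L, s * l * s⁻¹ ∈ L) (hLc : ∀ a ∈ L, ∀ b ∈ L, a * b = b * a) : L = ⊥ := by
  classical
  by_contra hL1
  set H := localCommensurator S
  have hSH : S ≤ H := le_localCommensurator S
  let A : G → Set G := fun h => {x | h⁻¹ * x * h ∈ L}
  let D : Subgroup G := Subgroup.closure (⋃ h ∈ (H : Set G), A h)
  have hDn : ∀ h ∈ H, ∀ d ∈ D, h * d * h⁻¹ ∈ D := by
    intro h hh d hd
    have hle : D ≤ D.comap (MulAut.conj h).toMonoidHom := by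
      refine (Subgroup.closure_le _).2 fun x hx => ?_
      obtain ⟨j, hj, hxj⟩ := Set.mem_iUnion₂.1 hx
      refine Subgroup.subset_closure (Set.mem_iUnion₂.2 ⟨h * j, H.mul_mem hh hj, ?_⟩)
      have : j⁻¹ * x * j ∈ L := hxj
      simpa [A, mul_assoc] using this
    exact hle hd
  have hLD : L ≤ D := fun l hl =>
    Subgroup.subset_closure (Set.mem_iUnion₂.2 ⟨1, H.one_mem, by simpa [A] using hl⟩)
  have hD1 : D ≠ ⊥ := fun h => hL1 (eq_bot_iff.2 (hLD.trans h.le))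
  obtain ⟨X, hX, W₀, hW₀o, hW₀⟩ := hM.exists_finset_forall_eq_bot
    (hM.subset_closure_inf hH hHM hDn hD1)
  -- `X` lies in the group generated by finitely many conjugates of `L`
  obtain ⟨F₀, hF₀, hXF₀⟩ : ∃ F₀ : Finset G, (∀ h ∈ F₀, h ∈ H) ∧
      ∀ x ∈ X, x ∈ Subgroup.closure (⋃ h ∈ F₀, A h) := by
    have h1 : ∀ x ∈ X, ∃ F : Finset G, (∀ h ∈ F, h ∈ (H : Set G)) ∧
        x ∈ Subgroup.closure (⋃ h ∈ F, A h) := fun x hx =>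
      Subgroup.exists_finset_mem_closure_biUnion (hX x hx).1
    choose! F hF hxF using h1
    refine ⟨X.biUnion F, fun h hh => ?_, fun x hx => ?_⟩
    · obtain ⟨x, hx, hhx⟩ := Finset.mem_biUnion.1 hh
      exact hF x hx h hhx
    · exact Subgroup.closure_mono (Set.biUnion_subset_biUnion_left
        (Finset.subset_biUnion_of_mem F hx)) (hxF x hx)
  let C : Finset G → Subgroup G := germCentralizer S L
  have hCH : ∀ F, C F ≤ H := germCentralizer_le S L
  let P : Finset G → Subgroup G := fun F => localClosure S (C F) (hCH F)
  have hPanti : ∀ {F F' : Finset G}, F ⊆ F' → P F' ≤ P F := fun h =>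
    localClosure_mono _ _ (germCentralizer_anti S L h)
  have hXC : ∀ F : Finset G, F₀ ⊆ F → (∀ h ∈ F, h ∈ H) → ∀ x ∈ X,
      x ∈ Subgroup.normalizer (C F : Set G) := by
    intro F hF₀F hF x hx
    have hle : Subgroup.closure (⋃ h ∈ F₀, A h) ≤ Subgroup.normalizer (C F : Set G) := by
      refine (Subgroup.closure_le _).2 fun y hy => ?_
      obtain ⟨h, hh, hyh⟩ := Set.mem_iUnion₂.1 hy
      have hyL : h⁻¹ * y * h ∈ L := hyh
      refine Subgroup.mem_normalizer_of_forall_conj_mem (fun q hq => ?_) fun q hq => ?_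
      · have := conj_mem_germCentralizer_of_mem hLS hL hF (hF₀F hh) hyL hq
        simpa [mul_assoc] using this
      · have := conj_mem_germCentralizer_of_mem hLS hL hF (hF₀F hh) (inv_mem hyL) hq
        simpa [mul_assoc] using this
    exact hle (hXF₀ x hx)
  have hXH : ∀ x ∈ X, x ∈ H := by
    intro x hx
    have hle : D ≤ H := by
      refine (Subgroup.closure_le _).2 fun y hy => ?_
      obtain ⟨h, hh, hyh⟩ := Set.mem_iUnion₂.1 hy
      have hyL : h⁻¹ * y * h ∈ L := hyh
      have := H.mul_mem (H.mul_mem hh (hSH (hLS hyL))) (H.inv_mem hh)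
      simpa [mul_assoc] using this
    exact hle (hX x hx).1
  -- `X` moves the group `P F ⊓ (S ⊓ W₀)`, so that `P F` meets one of the compact sets
  -- `x (S ⊓ W₀) x⁻¹ \ (S ⊓ W₀)` with `x` or `x⁻¹` in `X`
  let Z : G → Finset G → Set G := fun x F => {g | g ∈ P F ∧ x⁻¹ * g * x ∈ S ⊓ W₀ ∧ g ∉ S ⊓ W₀}
  let ι := {F : Finset G // F₀ ⊆ F ∧ ∀ h ∈ F, h ∈ H}
  let Y : ι → Set G := fun F => ⋃ x ∈ X, (Z x F.1 ∪ Z x⁻¹ F.1)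
  have hZc : ∀ x ∈ H, ∀ F, IsCompact (Z x F) := by
    intro x hx F
    have h1 : IsCompact ((fun s => x * s * x⁻¹) '' (S : Set G)) :=
      hSc.image (by fun_prop)
    refine h1.of_isClosed_subset
      (isClosed_localClosure_inter_conj (hCH F) hSc.isClosed hx hW₀o) fun g hg => ?_
    exact ⟨_, hg.2.1.1, by simp [mul_assoc]⟩
  have hYc : ∀ F, IsCompact (Y F) := fun F => X.isCompact_biUnion fun x hx =>
    (hZc x (hXH x hx) F.1).union (hZc x⁻¹ (H.inv_mem (hXH x hx)) F.1)
  have hYn : ∀ F, (Y F).Nonempty := by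
    rintro ⟨F, hF₀F, hF⟩
    obtain ⟨z, hzC, hzS, hz1⟩ := exists_mem_germCentralizer_ne_one hLS hL hLc hS hF hW₀o
    have hK : P F ⊓ (S ⊓ W₀) ≠ ⊥ := fun h => hz1 (by
      have : z ∈ P F ⊓ (S ⊓ W₀) := ⟨le_localClosure _ hzC, hzS⟩
      rwa [h, Subgroup.mem_bot] at this)
    by_contra hemp
    refine hK (hW₀ _ (inf_le_right.trans inf_le_right) fun x hx => ?_)
    have hxn := Subgroup.mem_normalizer_iff.1 (hXC F hF₀F hF x hx)
    have hxn' := Subgroup.mem_normalizer_iff.1 (inv_mem (hXC F hF₀F hF x hx))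
    refine Subgroup.mem_normalizer_of_forall_conj_mem (fun k hk => ?_) fun k hk => ?_
    · have h1 : x * k * x⁻¹ ∈ P F := conj_mem_localClosure _ _ (hXH x hx)
        (fun q hq => (hxn q).1 hq) hk.1
      refine ⟨h1, by_contra fun h2 => hemp ⟨x * k * x⁻¹, Set.mem_iUnion₂.2 ⟨x, hx, Or.inl ?_⟩⟩⟩
      exact ⟨h1, by simpa [mul_assoc] using hk.2, h2⟩
    · have h1 : x⁻¹ * k * x⁻¹⁻¹ ∈ P F := conj_mem_localClosure _ _ (H.inv_mem (hXH x hx))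
        (fun q hq => (hxn' q).1 hq) hk.1
      rw [inv_inv] at h1
      refine ⟨h1, by_contra fun h2 => hemp ⟨x⁻¹ * k * x, Set.mem_iUnion₂.2 ⟨x, hx, Or.inr ?_⟩⟩⟩
      exact ⟨h1, by simpa [mul_assoc] using hk.2, h2⟩
  have hYanti : ∀ F F' : ι, F.1 ⊆ F'.1 → Y F' ⊆ Y F := fun F F' h =>
    Set.iUnion₂_mono fun x _ => Set.union_subset_union
      (fun g hg => ⟨hPanti h hg.1, hg.2⟩) (fun g hg => ⟨hPanti h hg.1, hg.2⟩)
  have hdir : Directed (· ⊇ ·) Y := fun F F' =>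
    ⟨⟨F.1 ∪ F'.1, F.2.1.trans Finset.subset_union_left, fun h hh =>
      (Finset.mem_union.1 hh).elim (F.2.2 h) (F'.2.2 h)⟩,
      hYanti _ _ Finset.subset_union_left, hYanti _ _ Finset.subset_union_right⟩
  have : Nonempty ι := ⟨⟨F₀, subset_rfl, hF₀⟩⟩
  obtain ⟨z, hz⟩ := IsCompact.nonempty_iInter_of_directed_nonempty_isCompact_isClosed Y hdir hYn
    hYc fun F => (hYc F).isClosed
  have hzZ : ∀ F : ι, z ∈ P F.1 ∧ z ∉ S ⊓ W₀ := by
    intro F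
    obtain ⟨x, -, hzx | hzx⟩ := Set.mem_iUnion₂.1 (Set.mem_iInter.1 hz F)
    · exact ⟨hzx.1, hzx.2.2⟩
    · exact ⟨hzx.1, hzx.2.2⟩
  -- the intersection of all the closures is therefore non-trivial, and it is normal in `H`
  let Q : Subgroup G := ⨅ F : {F : Finset G // ∀ h ∈ F, h ∈ H}, P F.1
  have hzQ : z ∈ Q := by
    refine Subgroup.mem_iInf.2 fun F => hPanti (F' := F₀ ∪ F.1) Finset.subset_union_right ?_
    exact (hzZ ⟨F₀ ∪ F.1, Finset.subset_union_left, fun h hh =>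
      (Finset.mem_union.1 hh).elim (hF₀ h) (F.2 h)⟩).1
  have hQ1 : Q ≠ ⊥ := by
    intro h
    rw [h, Subgroup.mem_bot] at hzQ
    exact (hzZ ⟨F₀, subset_rfl, hF₀⟩).2 (hzQ ▸ one_mem _)
  have hQn : ∀ h ∈ H, ∀ q ∈ Q, h * q * h⁻¹ ∈ Q := by
    intro h hh q hq
    refine Subgroup.mem_iInf.2 fun F => ?_
    have h1 : q ∈ P (F.1.image (h⁻¹ * ·)) := by
      refine Subgroup.mem_iInf.1 hq ⟨F.1.image (h⁻¹ * ·), fun j hj => ?_⟩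
      obtain ⟨i, hi, rfl⟩ := Finset.mem_image.1 hj
      exact H.mul_mem (H.inv_mem hh) (F.2 i hi)
    exact conj_mem_localClosure _ _ hh (fun q hq => conj_mem_germCentralizer hh
      (fun j hj => Finset.mem_image_of_mem _ hj) hq) h1
  obtain ⟨X', hX', W', hW'o, hW'⟩ := hM.exists_finset_forall_eq_bot
    (hM.subset_closure_inf hH hHM hQn hQ1)
  -- each `x ∈ X'` is a product of an element centralising a germ of `L` and an element of `S`
  have hdecomp : ∀ x ∈ X', ∃ s ∈ S, ∀ᶠ y in 𝓝 (1 : G), y ∈ L → x * s * y = y * (x * s) := by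
    intro x hx
    have h1 : x ∈ P {1} := Subgroup.mem_iInf.1 (hX' x hx).1 ⟨{1}, by simp [H.one_mem]⟩
    obtain ⟨s, hs, hxs⟩ := h1 ⊤ isOpen_univ
    exact ⟨s, hs.1, by simpa using hxs.2 1 (by simp)⟩
  choose! s hsS hs using hdecomp
  obtain ⟨W₁, hW₁o, hW₁n, hW₁⟩ := hbasis _ (Filter.Eventually.and (hW'o.mem_nhds (one_mem W'))
    ((Finset.eventually_all X').2 hs))
  have hLW : L ⊓ W₁ = ⊥ := by
    refine hW' _ (fun y hy => (hW₁ hy.2).1) fun x hx => ?_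
    have h1 : x * s x ∈ Subgroup.normalizer ((L ⊓ W₁ : Subgroup G) : Set G) :=
      Subgroup.mem_normalizer_of_forall_commute fun k hk => (hW₁ hk.2).2 x hx hk.1
    have h2 : s x ∈ Subgroup.normalizer ((L ⊓ W₁ : Subgroup G) : Set G) :=
      Subgroup.mem_normalizer_of_forall_conj_mem
        (fun k hk => ⟨hL _ (hsS x hx) k hk.1, hW₁n _ (hsS x hx) k hk.2⟩)
        (fun k hk => ⟨by simpa using hL _ (inv_mem (hsS x hx)) k hk.1,
          by simpa using hW₁n _ (inv_mem (hsS x hx)) k hk.2⟩)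
    simpa using mul_mem h1 (inv_mem h2)
  refine hL1 (hM.eq_bot_of_discrete hH hHM hS hLS hL ?_)
  filter_upwards [hW₁o.mem_nhds (one_mem W₁)] with x hxW hxL
  have : x ∈ L ⊓ W₁ := ⟨hxL, hxW⟩
  rwa [hLW, Subgroup.mem_bot] at this

end LocallyNormal

/-! ### Reduction from virtually solvable to abelian or finite -/

section Solvable

variable {S : Type*} [Group S]

theorem Subgroup.isSolvable_sup {R R' : Subgroup S} [R'.Normal] (hR : Group.IsSolvable R)
    (hR' : Group.IsSolvable R') : Group.IsSolvable (R ⊔ R' : Subgroup S) := by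
  let π := QuotientGroup.mk' R'
  have hmap : (R ⊔ R').map π = R.map π := by
    rw [Subgroup.map_sup, QuotientGroup.map_mk'_self, sup_bot_eq]
  have h1 : Group.IsSolvable (R.map π) :=
    Group.isSolvable_of_surjective (π.subgroupMap_surjective R)
  have h2 : Group.IsSolvable ((R ⊔ R').map π) := hmap ▸ h1
  refine Group.isSolvable_of_ker_le_range (Subgroup.inclusion (le_sup_right (a := R) (b := R')))
    (π.subgroupMap (R ⊔ R')) fun x hx => ?_
  have hx' : π x = 1 := congrArg Subtype.val (MonoidHom.mem_ker.1 hx)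
  exact ⟨⟨x, (QuotientGroup.eq_one_iff (x : S)).1 hx'⟩, rfl⟩

/-- A virtually solvable group has a characteristic solvable subgroup of finite index: a normal
solvable subgroup of the smallest possible index contains all the others. -/
theorem IsVirtuallySolvable.exists_characteristic (hS : IsVirtuallySolvable S) :
    ∃ R : Subgroup S, R.Characteristic ∧ R.FiniteIndex ∧ Group.IsSolvable R := by
  obtain ⟨K, hKf, hK⟩ := hS
  let I : Set ℕ := {n | ∃ R : Subgroup S, R.Normal ∧ R.FiniteIndex ∧ Group.IsSolvable R ∧
    R.index = n}
  have hcore : Group.IsSolvable K.normalCore :=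
    Group.isSolvable_of_isSolvable_injective (Subgroup.inclusion_injective K.normalCore_le)
  have hne : I.Nonempty := ⟨_, K.normalCore, inferInstance, inferInstance, hcore, rfl⟩
  obtain ⟨R, hRn, hRf, hR, hRi⟩ := Nat.sInf_mem hne
  refine ⟨R, Subgroup.characteristic_iff_map_le.2 fun φ => ?_, hRf, hR⟩
  have h1 : (R.map φ.toMonoidHom).Normal := hRn.map _ φ.surjective
  have h2 : Group.IsSolvable (R.map φ.toMonoidHom) :=
    Group.isSolvable_of_surjective (φ.toMonoidHom.subgroupMap_surjective R)
  have h3 : (R ⊔ R.map φ.toMonoidHom).FiniteIndex := Subgroup.finiteIndex_of_le le_sup_left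
  have h4 : R.index ≤ (R ⊔ R.map φ.toMonoidHom).index :=
    hRi ▸ Nat.sInf_le ⟨_, inferInstance, h3, Subgroup.isSolvable_sup hR h2, rfl⟩
  by_contra hle
  exact (Subgroup.index_strictAnti (left_lt_sup.2 hle)).not_ge h4

theorem Subgroup.eq_bot_of_isSolvable
    (hab : ∀ L : Subgroup S, L.Normal → (∀ a ∈ L, ∀ b ∈ L, a * b = b * a) → L = ⊥)
    {L : Subgroup S} (hL : L.Normal) (hLs : Group.IsSolvable L) : L = ⊥ := by
  obtain ⟨n, hn⟩ := hLs.solvable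
  have key : ∀ n, derivedSeries L n = ⊥ → derivedSeries L 0 = ⊥ := by
    intro n
    induction n with
    | zero => exact id
    | succ n ih =>
      intro h
      refine ih ?_
      rw [derivedSeries_succ, Subgroup.commutator_eq_bot_iff_le_centralizer] at h
      refine (Subgroup.map_eq_bot_iff_of_injective _ L.subtype_injective).1
        (hab ((derivedSeries L n).map L.subtype) inferInstance ?_)
      rintro _ ⟨a, ha, rfl⟩ _ ⟨b, hb, rfl⟩
      exact (congrArg Subtype.val (Subgroup.mem_centralizer_iff.1 (h ha) b hb)).symm
  have h := key n hn
  rw [derivedSeries_zero] at h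
  refine eq_bot_iff.2 fun l hl => ?_
  have h1 : (⟨l, hl⟩ : L) ∈ (⊤ : Subgroup L) := Subgroup.mem_top _
  rw [h, Subgroup.mem_bot] at h1
  exact congrArg Subtype.val h1

theorem Subgroup.eq_bot_of_isVirtuallySolvable
    (hab : ∀ L : Subgroup S, L.Normal → (∀ a ∈ L, ∀ b ∈ L, a * b = b * a) → L = ⊥)
    (hfin : ∀ L : Subgroup S, L.Normal → Finite L → L = ⊥)
    {N : Subgroup S} (hN : N.Normal) (hNs : IsVirtuallySolvable N) : N = ⊥ := by
  obtain ⟨R, hRc, hRf, hR⟩ := hNs.exists_characteristic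
  have h1 : Group.IsSolvable (R.map N.subtype) :=
    Group.isSolvable_of_surjective (N.subtype.subgroupMap_surjective R)
  have h2 : R = ⊥ := (Subgroup.map_eq_bot_iff_of_injective _ N.subtype_injective).1
    (Subgroup.eq_bot_of_isSolvable hab inferInstance h1)
  refine hfin N hN (Nat.finite_of_card_ne_zero ?_)
  rw [← Subgroup.index_bot, ← h2]
  exact hRf.index_ne_zero

end Solvable

/-! ### Sylow subgroups of robustly monolithic groups -/

section Main

variable {G : Type*} [Group G] [TopologicalSpace G]

theorem IsRobustlyMonolithic.isExpansiveMonolith (hG : IsRobustlyMonolithic G) :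
    IsExpansiveMonolith (monolith G) where
  normal := ⟨fun n hn g => Subgroup.mem_sInf.2 fun N hN =>
    hN.1.conj_mem n (Subgroup.mem_sInf.1 hn N hN) g⟩
  isClosed := by
    rw [monolith, Subgroup.coe_sInf]
    exact isClosed_biInter fun N hN => hN.2.1
  le_of_normal N hN hNc hN1 := sInf_le ⟨hN, hNc, hN1⟩
  not_discrete W hW h := by
    have := hG.isTopologicalGroup
    refine hG.not_discreteTopology (discreteTopology_of_isOpen_singleton_one ?_)
    have h1 : ((↑) : monolith G → G) ⁻¹' W = {1} := by
      ext x
      refine ⟨fun hx => ?_, fun hx => ?_⟩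
      · have h2 : (x : G) ∈ W ⊓ monolith G := ⟨hx, x.2⟩
        rw [h, Subgroup.mem_bot] at h2
        exact Subtype.ext h2
      · rw [Set.mem_singleton_iff.1 hx]
        exact one_mem W
    exact h1 ▸ hW.preimage continuous_subtype_val
  expansive := hG.isRegionallyExpansive

theorem mem_closure_of_forall_exists_mul_mem [IsTopologicalGroup G] {A : Set G} {g : G}
    (h : ∀ B ∈ 𝓝 (1 : G), ∃ u ∈ B, u * g ∈ A) : g ∈ closure A := by
  refine mem_closure_iff_nhds.2 fun B hB => ?_
  have hcont : Tendsto (fun u : G => u * g) (𝓝 1) (𝓝 g) := by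
    have : Continuous fun u : G => u * g := by fun_prop
    simpa using this.tendsto 1
  obtain ⟨u, hu, hug⟩ := h _ (hcont hB)
  exact ⟨u * g, hu, hug⟩

/-- An infinite pro-`p`-Sylow subgroup of a compact open subgroup has no non-trivial normal subgroup
that is abelian or finite. -/
theorem IsRobustlyMonolithic.eq_bot_of_isProPSylow (hG : IsRobustlyMonolithic G) {U : Subgroup G}
    (hUc : IsCompact (U : Set G)) (hUo : IsOpen (U : Set G)) {p : ℕ} (hp : p.Prime)
    {S : Subgroup U} (hS : IsProPSylow p S) (hSinf : Infinite S) {L : Subgroup S} (hL : L.Normal)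
    (hL' : (∀ a ∈ L, ∀ b ∈ L, a * b = b * a) ∨ Finite L) : L = ⊥ := by
  have := hG.isTopologicalGroup
  have := hG.t2Space
  have := hG.totallyDisconnectedSpace
  have hcomp : CompactSpace U := isCompact_iff_compactSpace.1 hUc
  have hScomp : CompactSpace S := hS.isProP.compactSpace
  have hfact : Fact p.Prime := ⟨hp⟩
  have hna : NonarchimedeanGroup G :=
    { is_nonarchimedean := fun A hA => by
        obtain ⟨W, hWo, -, -, hWA⟩ := exists_open_subgroup_conj_mem hUc hUo hA
        exact ⟨⟨W, hWo⟩, hWA⟩ }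
  have hM := hG.isExpansiveMonolith
  let f : S →* G := U.subtype.comp S.subtype
  have hf : Continuous f := continuous_subtype_val.comp continuous_subtype_val
  have hfinj : Function.Injective f := U.subtype_injective.comp S.subtype_injective
  let S' : Subgroup G := S.map U.subtype
  have hfS : ∀ s, f s ∈ S' := fun s => ⟨s, s.2, rfl⟩
  have hSf : ∀ s ∈ S', ∃ t, f t = s := by
    rintro _ ⟨s, hs, rfl⟩
    exact ⟨⟨s, hs⟩, rfl⟩
  have hS'U : S' ≤ U := Subgroup.map_subtype_le S
  have hS'c : IsCompact (S' : Set G) := by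
    have : (S' : Set G) = Set.range f := by
      ext x
      exact ⟨fun hx => hSf x hx, fun ⟨s, hs⟩ => hs ▸ hfS s⟩
    rw [this]
    exact isCompact_range hf
  have hS'p : ∀ s ∈ S', ∀ A ∈ 𝓝 (1 : G), ∃ k : ℕ, s ^ p ^ k ∈ A := by
    intro s hs A hA
    obtain ⟨s, rfl⟩ := hSf s hs
    obtain ⟨W, hWo, -, hWn, hWA⟩ := exists_open_subgroup_conj_mem hUc hUo hA
    have hN : (W.comap f).Normal := ⟨fun w hw s => by
      have := hWn (f s) (hS'U (hfS s)) (f w) hw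
      simpa using this⟩
    obtain ⟨k, hk⟩ := hS.isProP.isPGroup_quotient (W.comap f) (hWo.preimage hf)
      (QuotientGroup.mk s)
    rw [← QuotientGroup.mk_pow, QuotientGroup.eq_one_iff, Subgroup.mem_comap, map_pow] at hk
    exact ⟨k, hWA hk⟩
  have hconj : ∀ R T : Subgroup G, IsClosed (R : Set G) → S' ≤ R → R ≤ U → T ≤ R →
      (∀ t ∈ T, ∀ A ∈ 𝓝 (1 : G), ∃ k : ℕ, t ^ p ^ k ∈ A) →
      ∃ y ∈ R, ∀ t ∈ T, y⁻¹ * t * y ∈ S' := by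
    intro R T hRc hSR hRU hTR hT
    obtain ⟨y, hyR, hy⟩ := exists_conj_mem_of_forall_not_dvd_index (p := p) (S := S)
      (R := R.subgroupOf U) (T := T.subgroupOf U) hS.isClosed
      (hRc.preimage continuous_subtype_val) (fun s hs => hSR ⟨s, hs, rfl⟩) (fun t ht => hTR ht)
      (fun B hB hSB => hS.not_dvd_index hB hSB) (fun t ht A hA => by
        obtain ⟨A', hA', hAA'⟩ := mem_nhds_induced _ _ _ |>.1 hA
        obtain ⟨k, hk⟩ := hT t ht A' hA'
        exact ⟨k, hAA' hk⟩)
    exact ⟨y, hyR, fun t ht => ⟨_, hy ⟨t, hRU (hTR ht)⟩ ht, rfl⟩⟩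
  have hcomm : ∀ {N : Subgroup G} [N.Normal], IsClosed (N : Set G) → ∀ m ∈ N, ∀ A ∈ 𝓝 (1 : G),
      ∃ u ∈ N, u ∈ A ∧ u * m ∈ localCommensurator S' := fun hNc m hm A hA =>
    exists_mul_mem_localCommensurator hUc hUo hS'c.isClosed hS'U hS'p hconj hNc hm hA
  have hH : Dense (localCommensurator S' : Set G) := fun g =>
    mem_closure_of_forall_exists_mul_mem fun A hA => by
      obtain ⟨u, -, huA, hu⟩ := hcomm (N := ⊤) isClosed_univ g (Subgroup.mem_top g) A hA
      exact ⟨u, huA, hu⟩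
  have hHM : (monolith G : Set G) ⊆
      closure (localCommensurator S' ⊓ monolith G : Subgroup G) := fun g hg =>
    mem_closure_of_forall_exists_mul_mem fun A hA => by
      have := hM.normal
      obtain ⟨u, huM, huA, hu⟩ := hcomm hM.isClosed g hg A hA
      exact ⟨u, huA, hu, mul_mem huM hg⟩
  have hS'nd : ∀ W : Subgroup G, IsOpen (W : Set G) → S' ⊓ W ≠ ⊥ := by
    intro W hW h
    have h1 : f ⁻¹' W = {1} := by
      ext x
      refine ⟨fun hx => ?_, fun hx => ?_⟩
      · have h2 : f x ∈ S' ⊓ W := ⟨hfS x, hx⟩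
        rw [h, Subgroup.mem_bot] at h2
        exact hfinj (h2.trans (map_one f).symm)
      · rw [Set.mem_singleton_iff.1 hx]
        exact one_mem (W.comap f)
    have : DiscreteTopology S :=
      discreteTopology_of_isOpen_singleton_one (h1 ▸ hW.preimage hf)
    exact hSinf.not_finite finite_of_compact_of_discrete
  have hLS : L.map f ≤ S' := by
    rintro _ ⟨l, -, rfl⟩
    exact hfS l
  have hLn : ∀ s ∈ S', ∀ l ∈ L.map f, s * l * s⁻¹ ∈ L.map f := by
    rintro s hs _ ⟨l, hl, rfl⟩
    obtain ⟨t, rfl⟩ := hSf s hs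
    exact ⟨t * l * t⁻¹, hL.conj_mem l hl t, by simp⟩
  refine (Subgroup.map_eq_bot_iff_of_injective _ hfinj).1 ?_
  rcases hL' with hab | hfin
  · refine hM.eq_bot_of_commute hS'c (fun A hA => ?_) hH hHM hS'nd hLS hLn ?_
    · obtain ⟨W, hWo, -, hWn, hWA⟩ := exists_open_subgroup_conj_mem hUc hUo hA
      exact ⟨W, hWo, fun s hs => hWn s (hS'U hs), hWA⟩
    · rintro _ ⟨a, ha, rfl⟩ _ ⟨b, hb, rfl⟩
      rw [← map_mul, hab a ha b hb, map_mul]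
  · refine hM.eq_bot_of_discrete hH hHM hS'nd hLS hLn ?_
    have hfin' : ((L.map f : Subgroup G) : Set G).Finite := by
      rw [Subgroup.coe_map]
      exact (Set.toFinite (L : Set S)).image f
    have hcl : IsClosed (((L.map f : Subgroup G) : Set G) \ {1}) :=
      (hfin'.subset Set.sdiff_subset).isClosed
    filter_upwards [hcl.isOpen_compl.mem_nhds (fun h => h.2 rfl)] with x hx hxL
    by_contra hx1
    exact hx ⟨hxL, hx1⟩

end Main

theorem mainTheorem6 {G : Type*} [Group G] [TopologicalSpace G]
    (hG : IsRobustlyMonolithic G)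
    (U : Subgroup G) (hUc : IsCompact (U : Set G)) (hUo : IsOpen (U : Set G))
    (p : ℕ) (hp : p.Prime)
    (S : Subgroup U) (hS : IsProPSylow p S) (hSinf : Infinite S) :
    (∀ N : Subgroup S, N.Normal → IsVirtuallySolvable N → N = ⊥) ∧ ¬ Group.IsSolvable S := by
  have hab : ∀ L : Subgroup S, L.Normal → (∀ a ∈ L, ∀ b ∈ L, a * b = b * a) → L = ⊥ :=
    fun L hL h => hG.eq_bot_of_isProPSylow hUc hUo hp hS hSinf hL (Or.inl h)
  have hfin : ∀ L : Subgroup S, L.Normal → Finite L → L = ⊥ :=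
    fun L hL h => hG.eq_bot_of_isProPSylow hUc hUo hp hS hSinf hL (Or.inr h)
  refine ⟨fun N hN hNs => Subgroup.eq_bot_of_isVirtuallySolvable hab hfin hN hNs, fun h => ?_⟩
  have h1 : (⊤ : Subgroup S) = ⊥ :=
    Subgroup.eq_bot_of_isSolvable hab inferInstance inferInstance
  exact top_ne_bot h1
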